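/- Let $p$ be an odd prime, let $\mathbb{C}_p$ be the completion of an algebraic closure of $\mathbb{Q}_p$, and let $X=\mathbb{Z}_p\times\mathbb{Z}/(p-1)\mathbb{Z}$, in which each integer $k$ is identified with $(k,\,k \bmod (p-1))$. *Serre's family.* For an even integer $k\ge 4$ let $G_k=-\frac{B_k}{2k}+\sum_{n\ge1}\sigma_{k-1}(n)q^n$ be the $q$-expansion of the classical Eisenstein series. For $(s,u)\in X$ with $u$ even and $(s,u)\neq(0,0)$, Serre's $p$-adic Eisenstein series $G^*_{s,u}\in\mathbb{C}_p[[q]]$ is the limit of $G_{k_i}$, uniform in all coefficients, for every sequence of even integers $k_i\ge4$ with $k_i\to\infty$ (archimedean) and $k_i\to(s,u)$ in $X$. *The extended family.* Let $\omega$ be the Teichmüller character, regarded as a $\mathbb{C}_p$-valued Dirichlet character modulo $p$; $\omega^0$ is the trivial character modulo $p$. For $0\ne x\in\mathbb{Z}_p$ put $\langle x\rangle=p^{-v_p(x)}x/\hat x$, where $\hat x=\lim_n (p^{-v_p(x)}x)^{p^n}$, and $\langle x\rangle^s=\sum_{n\ge0}\binom{s}{n}(\langle x\rangle-1)^n$.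 Let $\chi$ be an even Dirichlet character modulo $p^v$, $v\ge1$, extended to $\mathbb{Z}_p$ (so $\chi$ vanishes on $p\mathbb{Z}_p$), let $x\in\mathbb{Z}_p$, and let $s\in\mathbb{C}_p$ with $|s|_p<p^{(p-2)/(p-1)}$. For $s\ne1$ put $$\zeta_p(s,\chi,x)=\frac1{s-1}\int_{\mathbb{Z}_p}\chi(x+a)\langle x+a\rangle^{1-s}\,da,\qquad \int_{\mathbb{Z}_p}f(a)\,da=\lim_{N\to\infty}\frac1{p^N}\sum_{a=0}^{p^N-1}f(a),$$ and let $\zeta_p(1,\chi,x)=\lim_{t\to1,\,t\ne1}\zeta_p(t,\chi,x)$ whenever this limit exists. Put $$a_0(s,\chi,x)=\tfrac12\zeta_p(1-s,\chi,x),\qquad a_n(s,\chi,x)=\int_{\mathbb{Z}_p}\chi(x+a)\langle x+a\rangle^{s}\,d\mu_n(a)\quad(n\ge1),$$ where $\mu_n=\sum_{d\mid n,\ (p,d)=1}d^{-1}\delta_d$, $\delta_d(U)=1$ if $d\in U$ and $0$ otherwise, and $\int f\,d\mu=\lim_{N}\sum_{a=0}^{p^N-1}f(a)\,\mu(a+p^N\mathbb{Z}_p)$.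 Let $G^*(s,\chi,x)=\sum_{n\ge0}a_n(s,\chi,x)q^n$. **Proposition.** For all $(s,u)\in\mathbb{Z}_p\times\mathbb{Z}/(p-1)\mathbb{Z}$ with $u$ even and $(s,u)\ne(0,0)$, Serre's series $G^*_{s,u}$ exists (sequences $k_i$ as above exist, and all of them give the same uniform limit), and $$G^*(s,\omega^u,0)=G^*_{s,u}.$$ -/

import Mathlib

open Filter Topology

noncomputable section

namespace PadicEisenstein

variable (p : ℕ) [Fact p.Prime]

/-- The inclusion `ℤ_p ⊆ ℚ_p ⊆ ℂ_p`. -/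
def toCp : ℤ_[p] →+* ℂ_[p] :=
  (algebraMap ℚ_[p] ℂ_[p]).comp PadicInt.Coe.ringHom

/-! ### The Teichmüller representative and the projection `⟨x⟩` -/

/-- The Teichmüller representative `lim x ^ (p ^ n)` of a `p`-adic integer `x`
(the `(p - 1)`-st root of unity congruent to `x` if `x` is a unit, and `0` if `p ∣ x`). -/
def teich (x : ℤ_[p]) : ℤ_[p] := limUnder atTop fun n : ℕ => x ^ p ^ n

variable {p}

theorem dvd_pow_sub_self (x : ℤ_[p]) : (p : ℤ_[p]) ∣ x ^ p - x := by
  rw [← Ideal.mem_span_singleton, ← PadicInt.maximalIdeal_eq_span_p, ← PadicInt.ker_toZMod,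
    RingHom.mem_ker]
  simp [ZMod.pow_card]

theorem norm_pow_sub_pow_le {x y : ℤ_[p]} (h : (p : ℤ_[p]) ∣ x - y) (n : ℕ) :
    ‖x ^ p ^ n - y ^ p ^ n‖ ≤ ((p : ℝ)⁻¹) ^ n := by
  have h1 : (p : ℤ_[p]) ^ n ∣ x ^ p ^ n - y ^ p ^ n :=
    (pow_dvd_pow _ n.le_succ).trans (dvd_sub_pow_of_dvd_sub h n)
  obtain ⟨c, hc⟩ := h1
  rw [hc, norm_mul, norm_pow, PadicInt.norm_p]
  exact mul_le_of_le_one_right (by positivity) (PadicInt.norm_le_one c)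

theorem inv_p_lt_one : (p : ℝ)⁻¹ < 1 :=
  inv_lt_one_of_one_lt₀ (by exact_mod_cast (Fact.out : p.Prime).one_lt)

theorem tendsto_teich (x : ℤ_[p]) :
    Tendsto (fun n : ℕ => x ^ p ^ n) atTop (𝓝 (teich p x)) := by
  refine CauchySeq.tendsto_limUnder (cauchySeq_of_le_geometric (p : ℝ)⁻¹ 1 inv_p_lt_one fun n => ?_)
  rw [dist_comm, dist_eq_norm, one_mul, pow_succ', pow_mul]
  exact norm_pow_sub_pow_le (dvd_pow_sub_self x) n

theorem teich_one : teich p 1 = 1 :=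
  tendsto_nhds_unique (tendsto_teich 1) (by simp)

theorem teich_mul (x y : ℤ_[p]) : teich p (x * y) = teich p x * teich p y :=
  tendsto_nhds_unique (tendsto_teich (x * y))
    (by simpa only [mul_pow] using (tendsto_teich x).mul (tendsto_teich y))

theorem teich_congr {x y : ℤ_[p]} (h : (p : ℤ_[p]) ∣ x - y) : teich p x = teich p y := by
  have h0 : Tendsto (fun n : ℕ => x ^ p ^ n - y ^ p ^ n) atTop (𝓝 0) :=
    squeeze_zero_norm (norm_pow_sub_pow_le h)
      (tendsto_pow_atTop_nhds_zero_of_lt_one (by positivity) inv_p_lt_one)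
  exact sub_eq_zero.mp
    (tendsto_nhds_unique ((tendsto_teich x).sub (tendsto_teich y)) h0)

theorem teich_zero : teich p 0 = 0 := by
  refine tendsto_nhds_unique (tendsto_teich 0) ?_
  have h (n : ℕ) : (0 : ℤ_[p]) ^ p ^ n = 0 :=
    zero_pow (pow_ne_zero n (Fact.out : p.Prime).ne_zero)
  simp [h]

theorem dvd_natCast_sub {a b : ℕ} (h : a ≡ b [MOD p ^ 1]) : (p : ℤ_[p]) ∣ (a : ℤ_[p]) - b := by
  rw [pow_one] at h
  obtain ⟨c, hc⟩ := h.symm.dvd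
  exact ⟨(c : ℤ_[p]), by exact_mod_cast congrArg (Int.cast : ℤ → ℤ_[p]) hc⟩

variable (p)

/-- The Teichmüller character `ω`, as a Dirichlet character modulo `p = p ^ 1` with values
in `ℂ_p`. -/
def omega : DirichletCharacter ℂ_[p] (p ^ 1) where
  toFun a := toCp p (teich p (a.val : ℤ_[p]))
  map_one' := by
    rw [teich_congr (y := 1), teich_one, map_one]
    have := dvd_natCast_sub (p := p) (a := (1 : ZMod (p ^ 1)).val) (b := 1)
      ((ZMod.natCast_eq_natCast_iff _ _ _).mp (by simp))
    simpa using this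
  map_mul' a b := by
    rw [teich_congr (y := (a.val : ℤ_[p]) * (b.val : ℤ_[p])), teich_mul, map_mul]
    have := dvd_natCast_sub (p := p) (a := (a * b).val) (b := a.val * b.val)
      ((ZMod.natCast_eq_natCast_iff _ _ _).mp (by simp))
    simpa using this
  map_nonunit' a ha := by
    have hp : p ∣ a.val := by
      by_contra h
      refine ha ((ZMod.isUnit_iff_coprime a.val (p ^ 1)).mpr ?_ |> fun h' => by simpa using h')
      exact Nat.Coprime.pow_right 1 ((Nat.Prime.coprime_iff_not_dvd Fact.out).mpr h).symm
    rw [teich_congr (y := 0), teich_zero, map_zero]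
    obtain ⟨c, hc⟩ := hp
    exact ⟨(c : ℤ_[p]), by rw [hc]; simp⟩

/-- The power `ω ^ u` for `u ∈ ℤ/(p-1)ℤ`; in particular `ω ^ 0` is the trivial character
modulo `p`, which vanishes on multiples of `p`. -/
def omegaPow (u : ZMod (p - 1)) : DirichletCharacter ℂ_[p] (p ^ 1) := omega p ^ u.val

/-- The unit part `x / p ^ v(x)` of a nonzero `p`-adic integer. -/
def unitPart (x : ℤ_[p]) : ℤ_[p] :=
  open Classical in if h : x = 0 then 1 else (PadicInt.unitCoeff h : ℤ_[p])

/-- The projection `⟨x⟩ = p ^ (-v(x)) * x / x̂` of a nonzero `p`-adic integer `x`, where `x̂` is the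
Teichmüller representative of the unit part of `x`. (The value at `x = 0` plays no role.) -/
def angle (x : ℤ_[p]) : ℂ_[p] := toCp p (unitPart p x) / toCp p (teich p (unitPart p x))

/-- `⟨x⟩ ^ s = ∑ n, (s choose n) (⟨x⟩ - 1) ^ n` for `s ∈ ℂ_p`; the series converges for
`|s| < p ^ ((p - 2) / (p - 1))`. -/
def anglePow (x : ℤ_[p]) (s : ℂ_[p]) : ℂ_[p] := ∑' n : ℕ, Ring.choose s n * (angle p x - 1) ^ n

/-- The extension to `ℤ_p` of a Dirichlet character modulo `p ^ v`. -/
def charEval {v : ℕ} (χ : DirichletCharacter ℂ_[p] (p ^ v)) (x : ℤ_[p]) : ℂ_[p] :=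
  χ (PadicInt.toZModPow v x)

/-! ### `p`-adic integrals -/

/-- The Volkenborn integral `∫ f(a) da = lim p ^ (-N) ∑_{a < p ^ N} f(a)`. -/
def volkenborn (f : ℤ_[p] → ℂ_[p]) : ℂ_[p] :=
  limUnder atTop fun N : ℕ => ((p : ℂ_[p]) ^ N)⁻¹ * ∑ a ∈ Finset.range (p ^ N), f (a : ℤ_[p])

/-- The `δ`-measure at `d`. -/
def delta (d : ℤ_[p]) (U : Set ℤ_[p]) : ℂ_[p] := open Classical in if d ∈ U then 1 else 0

/-- The measure `μ_n = ∑_{d ∣ n, (p, d) = 1} d⁻¹ δ_d`. -/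
def mu (n : ℕ) (U : Set ℤ_[p]) : ℂ_[p] :=
  ∑ d ∈ n.divisors with Nat.Coprime p d, (d : ℂ_[p])⁻¹ * delta p (d : ℤ_[p]) U

/-- The coset `a + p ^ N ℤ_p`. -/
def coset (a : ℤ_[p]) (N : ℕ) : Set ℤ_[p] := {z | (p : ℤ_[p]) ^ N ∣ z - a}

/-- The integral `∫ f dμ` of a continuous function against a `p`-adic measure, as the limit of
the Riemann sums `∑_{a < p ^ N} f(a) μ(a + p ^ N ℤ_p)`. -/
def measureIntegral (μ : Set ℤ_[p] → ℂ_[p]) (f : ℤ_[p] → ℂ_[p]) : ℂ_[p] :=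
  limUnder atTop fun N : ℕ =>
    ∑ a ∈ Finset.range (p ^ N), f (a : ℤ_[p]) * μ (coset p (a : ℤ_[p]) N)

/-! ### The extended family `G*(s, χ, x)`

Here `χ` is an even Dirichlet character modulo `p ^ v` with `v ≥ 1`, `x ∈ ℤ_p`, and
`s ∈ ℂ_p` with `|s| < p ^ ((p - 2) / (p - 1))`. -/

/-- `1 / (s - 1) * ∫ χ(x + a) ⟨x + a⟩ ^ (1 - s) da`, for `s ≠ 1`. -/
def hurwitzZetaAux {v : ℕ} (s : ℂ_[p]) (χ : DirichletCharacter ℂ_[p] (p ^ v)) (x : ℤ_[p]) :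
    ℂ_[p] :=
  1 / (s - 1) * volkenborn p fun a => charEval p χ (x + a) * anglePow p (x + a) (1 - s)

/-- The `p`-adic Hurwitz zeta function `ζ_p(s, χ, x)` for `x ∈ ℤ_p`. It is given by the Volkenborn
integral for `s ≠ 1`; at `s = 1` it is the limit for `s → 1`, `s ≠ 1`, whenever this exists
(removable singularity). -/
def hurwitzZeta {v : ℕ} (s : ℂ_[p]) (χ : DirichletCharacter ℂ_[p] (p ^ v)) (x : ℤ_[p]) : ℂ_[p] :=
  open Classical in
  if s = 1 then limUnder (𝓝[≠] (1 : ℂ_[p])) fun t => hurwitzZetaAux p t χ x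
  else hurwitzZetaAux p s χ x

/-- The coefficients `a_n(s, χ, x)`: `a_0 = ζ_p(1 - s, χ, x) / 2`, and
`a_n = ∫ χ(x + a) ⟨x + a⟩ ^ s dμ_n(a)` for `n ≥ 1`. -/
def familyCoeff {v : ℕ} (s : ℂ_[p]) (χ : DirichletCharacter ℂ_[p] (p ^ v)) (x : ℤ_[p]) (n : ℕ) :
    ℂ_[p] :=
  if n = 0 then 1 / 2 * hurwitzZeta p (1 - s) χ x
  else measureIntegral p (mu p n) fun a => charEval p χ (x + a) * anglePow p (x + a) s

/-- The `q`-expansion `G*(s, χ, x) = ∑_{n ≥ 0} a_n(s, χ, x) q ^ n`. -/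
def family {v : ℕ} (s : ℂ_[p]) (χ : DirichletCharacter ℂ_[p] (p ^ v)) (x : ℤ_[p]) :
    PowerSeries ℂ_[p] :=
  PowerSeries.mk (familyCoeff p s χ x)

/-! ### Serre's `p`-adic family of Eisenstein series -/

/-- The `q`-expansion `G_k = -B_k / (2k) + ∑_{n ≥ 1} σ_{k-1}(n) q ^ n` of the classical Eisenstein
series of weight `k`. -/
def classicalEisenstein (k : ℕ) : PowerSeries ℚ :=
  PowerSeries.mk fun n =>
    if n = 0 then -bernoulli k / (2 * k) else (ArithmeticFunction.sigma (k - 1) n : ℚ)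

variable {p} in
/-- `k 0, k 1, …` are even integers `≥ 4` which tend to infinity in the archimedean sense and
to `(s, u)` in the weight space `X = ℤ_p × ℤ/(p-1)ℤ`. -/
structure IsWeightSeq (s : ℤ_[p]) (u : ZMod (p - 1)) (k : ℕ → ℕ) : Prop where
  four_le : ∀ i, 4 ≤ k i
  even : ∀ i, Even (k i)
  tendsto_atTop : Tendsto k atTop atTop
  weight : Tendsto (fun i => ((k i : ℤ_[p]), (k i : ZMod (p - 1)))) atTop (𝓝 (s, u))

variable {p} in
/-- `f` is Serre's `p`-adic Eisenstein series of weight `(s, u)`: the weight `(s, u)` is a limit of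
classical weights, and whenever `k i → (s, u)` as above, the `q`-expansions of the classical
Eisenstein series `G_{k i}` converge to `f`, uniformly in all coefficients. -/
structure IsSerreEisenstein (s : ℤ_[p]) (u : ZMod (p - 1)) (f : PowerSeries ℂ_[p]) : Prop where
  exists_seq : ∃ k, IsWeightSeq s u k
  limit : ∀ k, IsWeightSeq s u k →
    TendstoUniformly
      (fun i n => ((PowerSeries.coeff n (classicalEisenstein (k i)) : ℚ) : ℂ_[p]))
      (fun n => PowerSeries.coeff n f) atTop

variable {p} in
theorem IsSerreEisenstein.unique {s : ℤ_[p]} {u : ZMod (p - 1)} {f g : PowerSeries ℂ_[p]}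
    (hf : IsSerreEisenstein s u f) (hg : IsSerreEisenstein s u g) : f = g := by
  obtain ⟨k, hk⟩ := hf.exists_seq
  ext n
  exact tendsto_nhds_unique ((hf.limit k hk).tendsto_at n) ((hg.limit k hk).tendsto_at n)

/-- Serre's `p`-adic Eisenstein series `G*_{s,u}`, the unique `q`-expansion satisfying
`IsSerreEisenstein s u` (if there is one). -/
def serreEisenstein (s : ℤ_[p]) (u : ZMod (p - 1)) : PowerSeries ℂ_[p] :=
  Classical.epsilon (IsSerreEisenstein s u)

end PadicEisenstein

end

/-!
On units `ω ^ u (x) ⟨x⟩ ^ s` is the Newton series `∑ n, (s choose n) ω ^ u (x) (⟨x⟩ - 1) ^ n`. Since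
`‖⟨x⟩ - 1‖ ≤ p⁻¹` and the constants of second-order Taylor estimates multiply under products, the
Volkenborn moments `M n` of `ω ^ u (⟨x⟩ - 1) ^ n` are `O(p ^ (-n))`. Hence the integral of
`ω ^ u ⟨x⟩ ^ s` is `M 0 + s Q(s)` with `Q` continuous, and
`ζ_p(1 - s, ω ^ u, 0) = -(M 0 / s + Q(s))` is continuous at every `s ≠ 0`, and also at `0` if
`u ≠ 0`, as then `M 0 = 0` by orthogonality.

For a natural number `k ≡ u mod (p - 1)` and `p ∤ a` one has `ω ^ u (a) ⟨a⟩ ^ k = a ^ k`. So at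
`s = k` the constant term of the family is `-B_k / (2 k)` times the Euler factor `1 - p ^ (k - 1)`,
which tends to `1`, while its `n`-th coefficient is `σ_{k - 1}(n)` without the divisors divisible by
`p`, and these contribute `O(p ^ (-(k - 1)))`. As `⟨d⟩ ^ s` is `1`-Lipschitz in `s` on the unit
ball, the convergence is uniform in `n`.
-/

namespace PadicEisenstein

variable {p : ℕ} [Fact p.Prime]

section ToCp

theorem norm_toCp (x : ℤ_[p]) : ‖toCp p x‖ = ‖x‖ := by
  rw [toCp, RingHom.comp_apply, norm_algebraMap']
  rfl

theorem isometry_toCp : Isometry (toCp p) :=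
  AddMonoidHomClass.isometry_of_norm (toCp p) norm_toCp

theorem norm_toCp_le_one (x : ℤ_[p]) : ‖toCp p x‖ ≤ 1 :=
  (norm_toCp x).trans_le x.norm_le_one

theorem toCp_eq_zero_iff {x : ℤ_[p]} : toCp p x = 0 ↔ x = 0 :=
  map_eq_zero_iff (toCp p) isometry_toCp.injective

theorem norm_natCast (m : ℕ) : ‖(m : ℂ_[p])‖ = ‖(m : ℤ_[p])‖ := by
  rw [← map_natCast (toCp p), norm_toCp]

theorem one_le_p : (1 : ℝ) ≤ p :=
  Nat.one_le_cast.mpr (Fact.out : p.Prime).one_le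

theorem norm_p : ‖(p : ℂ_[p])‖ = (p : ℝ)⁻¹ := by
  rw [norm_natCast, PadicInt.norm_p]

theorem p_ne_zero : (p : ℂ_[p]) ≠ 0 :=
  Nat.cast_ne_zero.mpr (Fact.out : p.Prime).ne_zero

theorem tendsto_p_pow : Tendsto (fun N : ℕ => (p : ℂ_[p]) ^ N) atTop (𝓝 0) :=
  tendsto_pow_atTop_nhds_zero_of_norm_lt_one (norm_p.trans_lt inv_p_lt_one)

theorem norm_le_inv_p_pow_iff_dvd {x : ℤ_[p]} {n : ℕ} :
    ‖x‖ ≤ (p : ℝ)⁻¹ ^ n ↔ (p : ℤ_[p]) ^ n ∣ x := by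
  rw [inv_pow, ← zpow_natCast, ← zpow_neg, PadicInt.norm_le_pow_iff_mem_span_pow,
    Ideal.mem_span_singleton]

theorem norm_le_inv_p_iff_dvd {x : ℤ_[p]} : ‖x‖ ≤ (p : ℝ)⁻¹ ↔ (p : ℤ_[p]) ∣ x := by
  simpa using norm_le_inv_p_pow_iff_dvd (x := x) (n := 1)

end ToCp

section Units

theorem isUnit_iff_not_dvd {x : ℤ_[p]} : IsUnit x ↔ ¬(p : ℤ_[p]) ∣ x := by
  rw [← PadicInt.norm_lt_one_iff_dvd, ← PadicInt.not_isUnit_iff, not_not]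

theorem isUnit_natCast_iff {n : ℕ} : IsUnit (n : ℤ_[p]) ↔ p.Coprime n := by
  rw [PadicInt.isUnit_iff, PadicInt.norm_natCast_eq_one_iff]

theorem isUnit_add_iff {x h : ℤ_[p]} (hh : (p : ℤ_[p]) ∣ h) : IsUnit (x + h) ↔ IsUnit x := by
  rw [isUnit_iff_not_dvd, isUnit_iff_not_dvd, dvd_add_left hh]

theorem dvd_teich_sub (x : ℤ_[p]) : (p : ℤ_[p]) ∣ teich p x - x := by
  rw [← norm_le_inv_p_iff_dvd]
  refine le_of_tendsto ((tendsto_teich x).sub_const x).norm (Eventually.of_forall fun n => ?_)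
  rw [norm_le_inv_p_iff_dvd]
  induction n with
  | zero => simp
  | succ n ih =>
    rw [pow_succ, pow_mul]
    simpa using dvd_add (dvd_pow_sub_self (x ^ p ^ n)) ih

theorem teich_pow (x : ℤ_[p]) (n : ℕ) : teich p (x ^ n) = teich p x ^ n := by
  induction n with
  | zero => simp [teich_one]
  | succ n ih => rw [pow_succ, teich_mul, ih, pow_succ]

theorem isUnit_teich {x : ℤ_[p]} (hx : IsUnit x) : IsUnit (teich p x) := by
  simpa using (isUnit_add_iff (dvd_teich_sub x)).mpr hx

theorem norm_toCp_teich {x : ℤ_[p]} (hx : IsUnit x) : ‖toCp p (teich p x)‖ = 1 := by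
  rw [norm_toCp, ← PadicInt.isUnit_iff]
  exact isUnit_teich hx

theorem toCp_teich_ne_zero {x : ℤ_[p]} (hx : IsUnit x) : toCp p (teich p x) ≠ 0 :=
  norm_ne_zero_iff.mp ((norm_toCp_teich hx).trans_ne one_ne_zero)

theorem teich_pow_sub_one {x : ℤ_[p]} (hx : IsUnit x) : teich p x ^ (p - 1) = 1 := by
  refine (isUnit_teich hx).mul_left_cancel ?_
  rw [← pow_succ', Nat.sub_add_cancel (Fact.out : p.Prime).one_le, mul_one, ← teich_pow]
  exact teich_congr (dvd_pow_sub_self x)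

theorem teich_pow_congr {x : ℤ_[p]} (hx : IsUnit x) {k l : ℕ} (hkl : (k : ZMod (p - 1)) = l) :
    teich p x ^ k = teich p x ^ l :=
  pow_eq_pow_of_modEq ((ZMod.natCast_eq_natCast_iff _ _ _).mp hkl) (teich_pow_sub_one hx)

theorem unitPart_of_isUnit {x : ℤ_[p]} (hx : IsUnit x) : unitPart p x = x := by
  rw [unitPart, dif_neg hx.ne_zero]
  have hv : x.valuation = 0 := by
    have hnorm := PadicInt.isUnit_iff.mp hx
    rw [PadicInt.norm_eq_zpow_neg_valuation hx.ne_zero, zpow_eq_one_iff_right₀ (by positivity)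
      (by exact_mod_cast (Fact.out : p.Prime).ne_one)] at hnorm
    simpa using hnorm
  simpa [hv] using (PadicInt.unitCoeff_spec hx.ne_zero).symm

theorem angle_of_isUnit {x : ℤ_[p]} (hx : IsUnit x) :
    angle p x = toCp p x / toCp p (teich p x) := by
  rw [angle, unitPart_of_isUnit hx]

theorem toCp_teich_mul_angle {x : ℤ_[p]} (hx : IsUnit x) :
    toCp p (teich p x) * angle p x = toCp p x := by
  rw [angle_of_isUnit hx, mul_div_cancel₀ _ (toCp_teich_ne_zero hx)]

theorem norm_angle_sub_one_le {x : ℤ_[p]} (hx : IsUnit x) : ‖angle p x - 1‖ ≤ (p : ℝ)⁻¹ := by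
  rw [angle_of_isUnit hx, div_sub_one (toCp_teich_ne_zero hx), norm_div, norm_toCp_teich hx,
    div_one, ← map_sub, norm_toCp, norm_le_inv_p_iff_dvd, dvd_sub_comm]
  exact dvd_teich_sub x

theorem angle_add {x h : ℤ_[p]} (hx : IsUnit x) (hh : (p : ℤ_[p]) ∣ h) :
    angle p (x + h) = angle p x + (toCp p (teich p x))⁻¹ * toCp p h := by
  have hteich : teich p (x + h) = teich p x := teich_congr (by simpa using hh)
  rw [angle_of_isUnit hx, angle_of_isUnit ((isUnit_add_iff hh).mpr hx), hteich, map_add]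
  ring

end Units

section Characters

variable {v : ℕ} (χ : DirichletCharacter ℂ_[p] (p ^ v))

theorem charEval_add {x h : ℤ_[p]} (hh : (p : ℤ_[p]) ^ v ∣ h) :
    charEval p χ (x + h) = charEval p χ x := by
  rw [← Ideal.mem_span_singleton, ← PadicInt.ker_toZModPow, RingHom.mem_ker] at hh
  rw [charEval, charEval, map_add, hh, add_zero]

theorem charEval_natCast (a : ℕ) : charEval p χ (a : ℤ_[p]) = χ (a : ZMod (p ^ v)) := by
  rw [charEval, map_natCast]

theorem norm_charEval_le_one (x : ℤ_[p]) : ‖charEval p χ x‖ ≤ 1 :=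
  χ.norm_le_one _

theorem charEval_of_not_isUnit (hv : v ≠ 0) {x : ℤ_[p]} (hx : ¬IsUnit x) :
    charEval p χ x = 0 := by
  have : Fact (1 < p ^ v) := ⟨Nat.one_lt_pow hv (Fact.out : p.Prime).one_lt⟩
  obtain ⟨c, rfl⟩ : (p : ℤ_[p]) ∣ x := not_not.mp (mt isUnit_iff_not_dvd.mpr hx)
  refine χ.map_nonunit (IsNilpotent.not_isUnit ⟨v, ?_⟩)
  rw [map_mul, mul_pow, map_natCast, ← Nat.cast_pow, ZMod.natCast_self, zero_mul]

theorem omega_natCast (a : ℕ) : omega p (a : ZMod (p ^ 1)) = toCp p (teich p (a : ℤ_[p])) :=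
  congrArg (toCp p) (teich_congr
    (dvd_natCast_sub ((ZMod.natCast_eq_natCast_iff _ _ _).mp (ZMod.natCast_zmod_val _))))

theorem charEval_omegaPow (u : ZMod (p - 1)) {a : ℕ} (ha : p.Coprime a) :
    charEval p (omegaPow p u) (a : ℤ_[p]) = toCp p (teich p (a : ℤ_[p]) ^ u.val) := by
  obtain ⟨b, hb⟩ := (ZMod.isUnit_iff_coprime a (p ^ 1)).mpr (ha.symm.pow_right 1)
  rw [charEval_natCast, omegaPow, ← hb, MulChar.pow_apply_coe, hb, omega_natCast, map_pow]

theorem toZMod_teich (x : ℤ_[p]) : PadicInt.toZMod (teich p x) = PadicInt.toZMod x := by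
  have h := dvd_teich_sub x
  rwa [← Ideal.mem_span_singleton, ← PadicInt.maximalIdeal_eq_span_p, ← PadicInt.ker_toZMod,
    RingHom.mem_ker, map_sub, sub_eq_zero] at h

theorem neZero_p_sub_one : NeZero (p - 1) :=
  ⟨(Nat.sub_pos_of_lt (Fact.out : p.Prime).one_lt).ne'⟩

theorem omegaPow_ne_one {u : ZMod (p - 1)} (hu : u ≠ 0) : omegaPow p u ≠ 1 := by
  have := neZero_p_sub_one (p := p)
  intro h
  have pow_eq_one (x : (ZMod p)ˣ) : x ^ u.val = 1 := by
    have hx : p.Coprime (x : ZMod p).val := (ZMod.val_coe_unit_coprime x).symm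
    have hunit : IsUnit (((x : ZMod p).val : ℕ) : ZMod (p ^ 1)) :=
      (ZMod.isUnit_iff_coprime _ _).mpr (hx.symm.pow_right 1)
    have hteich : teich p ((x : ZMod p).val : ℤ_[p]) ^ u.val = 1 := by
      refine isometry_toCp.injective ?_
      rw [← charEval_omegaPow u hx, h, charEval_natCast, MulChar.one_apply hunit, map_one]
    have hmod := congrArg PadicInt.toZMod hteich
    rw [map_pow, toZMod_teich, map_natCast, ZMod.natCast_zmod_val, map_one] at hmod
    exact Units.ext (by simpa using hmod)
  have hdvd := (FiniteField.forall_pow_eq_one_iff (ZMod p) u.val).mp pow_eq_one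
  rw [ZMod.card] at hdvd
  exact hu ((ZMod.val_eq_zero u).mp (Nat.eq_zero_of_dvd_of_lt hdvd (ZMod.val_lt u)))

end Characters

section TaylorBound

theorem norm_sub_le_max {S : Type*} [SeminormedAddGroup S] [IsUltrametricDist S] (x y : S) :
    ‖x - y‖ ≤ max ‖x‖ ‖y‖ := by
  simpa only [sub_eq_add_neg, norm_neg] using IsUltrametricDist.norm_add_le_max x (-y)

/-- `f` is differentiable on `ℤ_p` with derivative `f'` and a uniform second-order Taylor
estimate. The bounds are homogeneous: `A` is the size of `f` and `R⁻¹` the scale on which `f`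
varies, so that products multiply the constants `A` and keep `R`. -/
structure HasTaylorBound (R A : ℝ) (f f' : ℤ_[p] → ℂ_[p]) : Prop where
  norm_le : ∀ x, ‖f x‖ ≤ A
  norm_deriv_le : ∀ x, ‖f' x‖ ≤ A * R
  norm_deriv_sub_le : ∀ x h, ‖f' (x + h) - f' x‖ ≤ A * R ^ 2 * ‖h‖
  norm_taylor_le : ∀ x h, ‖f (x + h) - f x - f' x * toCp p h‖ ≤ A * R ^ 2 * ‖h‖ ^ 2

namespace HasTaylorBound

variable {R A B : ℝ} {f f' g g' : ℤ_[p] → ℂ_[p]}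

theorem nonneg (hf : HasTaylorBound R A f f') : 0 ≤ A :=
  (norm_nonneg _).trans (hf.norm_le 0)

theorem norm_sub_le (hf : HasTaylorBound R A f f') (hR : 0 ≤ R) (x h : ℤ_[p]) :
    ‖f (x + h) - f x‖ ≤ A * (R * ‖h‖) := by
  have hA := hf.nonneg
  rcases le_total (R * ‖h‖) 1 with hsmall | hlarge
  · rw [← sub_add_cancel (f (x + h) - f x) (f' x * toCp p h)]
    refine (IsUltrametricDist.norm_add_le_max _ _).trans (max_le ?_ ?_)
    · calc _ ≤ A * R ^ 2 * ‖h‖ ^ 2 := hf.norm_taylor_le x h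
        _ = A * (R * ‖h‖) * (R * ‖h‖) := by ring
        _ ≤ A * (R * ‖h‖) := mul_le_of_le_one_right (by positivity) hsmall
    · rw [norm_mul, norm_toCp, ← mul_assoc]
      exact mul_le_mul_of_nonneg_right (hf.norm_deriv_le x) (norm_nonneg h)
  · exact (norm_sub_le_max _ _).trans (max_le (hf.norm_le _) (hf.norm_le _))
      |>.trans (le_mul_of_one_le_right hA hlarge)

theorem const (hR : 0 ≤ R) (c : ℂ_[p]) :
    HasTaylorBound R ‖c‖ (fun _ : ℤ_[p] => c) (fun _ => 0) where
  norm_le _ := le_rfl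
  norm_deriv_le _ := by simpa using by positivity
  norm_deriv_sub_le _ _ := by simpa using by positivity
  norm_taylor_le _ _ := by simpa using by positivity

theorem mul (hf : HasTaylorBound R A f f') (hg : HasTaylorBound R B g g') (hR : 0 ≤ R) :
    HasTaylorBound R (A * B) (fun x => f x * g x) (fun x => f' x * g x + f x * g' x) := by
  have mul_bound {y z : ℂ_[p]} {a b c : ℝ} (hy : ‖y‖ ≤ a) (hz : ‖z‖ ≤ b) (hc : a * b = c) :
      ‖y * z‖ ≤ c :=
    (norm_mul y z).trans_le (hc ▸ mul_le_mul hy hz (norm_nonneg z) ((norm_nonneg y).trans hy))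
  have add_bound {y z : ℂ_[p]} {c : ℝ} (hy : ‖y‖ ≤ c) (hz : ‖z‖ ≤ c) : ‖y + z‖ ≤ c :=
    (IsUltrametricDist.norm_add_le_max y z).trans (max_le hy hz)
  refine ⟨fun x => mul_bound (hf.norm_le x) (hg.norm_le x) rfl, fun x => ?_, fun x h => ?_,
    fun x h => ?_⟩
  · exact add_bound (mul_bound (hf.norm_deriv_le x) (hg.norm_le x) (by ring))
      (mul_bound (hf.norm_le x) (hg.norm_deriv_le x) (by ring))
  · have split : f' (x + h) * g (x + h) + f (x + h) * g' (x + h) - (f' x * g x + f x * g' x) =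
        ((f' (x + h) - f' x) * g (x + h) + f' x * (g (x + h) - g x)) +
          ((f (x + h) - f x) * g' (x + h) + f x * (g' (x + h) - g' x)) := by ring
    rw [split]
    exact add_bound
      (add_bound (mul_bound (hf.norm_deriv_sub_le x h) (hg.norm_le _) (by ring))
        (mul_bound (hf.norm_deriv_le x) (hg.norm_sub_le hR x h) (by ring)))
      (add_bound (mul_bound (hf.norm_sub_le hR x h) (hg.norm_deriv_le _) (by ring))
        (mul_bound (hf.norm_le x) (hg.norm_deriv_sub_le x h) (by ring)))
  · have split : f (x + h) * g (x + h) - f x * g x - (f' x * g x + f x * g' x) * toCp p h =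
        (f (x + h) - f x - f' x * toCp p h) * g (x + h) +
          (f' x * (g (x + h) - g x) * toCp p h +
            f x * (g (x + h) - g x - g' x * toCp p h)) := by ring
    rw [split]
    exact add_bound (mul_bound (hf.norm_taylor_le x h) (hg.norm_le _) (by ring))
      (add_bound
        (mul_bound (mul_bound (hf.norm_deriv_le x) (hg.norm_sub_le hR x h) rfl)
          (norm_toCp h).le (by ring))
        (mul_bound (hf.norm_le x) (hg.norm_taylor_le x h) (by ring)))

theorem const_mul (hf : HasTaylorBound R A f f') (hR : 0 ≤ R) (c : ℂ_[p]) :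
    HasTaylorBound R (‖c‖ * A) (fun x => c * f x) (fun x => c * f' x) := by
  simpa using (const hR c).mul hf hR

theorem pow (hf : HasTaylorBound R A f f') (hR : 0 ≤ R) (n : ℕ) :
    HasTaylorBound R (A ^ n) (fun x => f x ^ n) (fun x => n * f x ^ (n - 1) * f' x) := by
  induction n with
  | zero => simpa using const hR (1 : ℂ_[p])
  | succ n ih =>
    convert ih.mul hf hR using 2 with x x
    · rfl
    · exact pow_succ _ _
    · rcases n with _ | n
      · simp
      · push_cast
        ring

theorem comp_add_left (hf : HasTaylorBound R A f f') (c : ℤ_[p]) :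
    HasTaylorBound R A (fun x => f (c + x)) (fun x => f' (c + x)) where
  norm_le x := hf.norm_le (c + x)
  norm_deriv_le x := hf.norm_deriv_le (c + x)
  norm_deriv_sub_le x h := by simpa only [add_assoc] using hf.norm_deriv_sub_le (c + x) h
  norm_taylor_le x h := by simpa only [add_assoc] using hf.norm_taylor_le (c + x) h

theorem of_locally_affine {v : ℕ} (hf : ∀ x, ‖f x‖ ≤ A) (hf' : ∀ x, ‖f' x‖ ≤ A * (p : ℝ) ^ v)
    (hadd : ∀ x h, (p : ℤ_[p]) ^ v ∣ h → f (x + h) = f x + f' x * toCp p h)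
    (hadd' : ∀ x h, (p : ℤ_[p]) ^ v ∣ h → f' (x + h) = f' x) :
    HasTaylorBound ((p : ℝ) ^ v) A f f' := by
  have hA : 0 ≤ A := (norm_nonneg _).trans (hf 0)
  have large {h : ℤ_[p]} (hh : ¬(p : ℤ_[p]) ^ v ∣ h) : 1 ≤ (p : ℝ) ^ v * ‖h‖ := by
    have hp : (0 : ℝ) < (p : ℝ) ^ v :=
      pow_pos (Nat.cast_pos.mpr (Fact.out : p.Prime).pos) v
    rw [← norm_le_inv_p_pow_iff_dvd, not_le, inv_pow, inv_lt_iff_one_lt_mul₀' hp] at hh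
    exact hh.le
  refine ⟨hf, hf', fun x h => ?_, fun x h => ?_⟩
  · by_cases hh : (p : ℤ_[p]) ^ v ∣ h
    · rw [hadd' x h hh, sub_self, norm_zero]
      positivity
    · calc ‖f' (x + h) - f' x‖ ≤ A * (p : ℝ) ^ v :=
            (norm_sub_le_max _ _).trans (max_le (hf' _) (hf' _))
        _ ≤ A * (p : ℝ) ^ v * ((p : ℝ) ^ v * ‖h‖) :=
            le_mul_of_one_le_right (by positivity) (large hh)
        _ = A * ((p : ℝ) ^ v) ^ 2 * ‖h‖ := by ring
  · by_cases hh : (p : ℤ_[p]) ^ v ∣ h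
    · rw [hadd x h hh, add_sub_cancel_left, sub_self, norm_zero]
      positivity
    · have hAh : A ≤ A * ((p : ℝ) ^ v * ‖h‖) := le_mul_of_one_le_right hA (large hh)
      calc ‖f (x + h) - f x - f' x * toCp p h‖ ≤ A * ((p : ℝ) ^ v * ‖h‖) := by
            refine (norm_sub_le_max _ _).trans (max_le ?_ ?_)
            · exact (norm_sub_le_max _ _).trans
                (max_le ((hf _).trans hAh) ((hf _).trans hAh))
            · rw [norm_mul, norm_toCp, ← mul_assoc]
              exact mul_le_mul_of_nonneg_right (hf' x) (norm_nonneg h)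
        _ ≤ A * ((p : ℝ) ^ v * ‖h‖) * ((p : ℝ) ^ v * ‖h‖) :=
            le_mul_of_one_le_right (by positivity) (large hh)
        _ = A * ((p : ℝ) ^ v) ^ 2 * ‖h‖ ^ 2 := by ring

end HasTaylorBound

end TaylorBound

section Volkenborn

theorem sum_range_mul_eq {M : Type*} [AddCommMonoid M] (f : ℕ → M) (n m : ℕ) :
    ∑ x ∈ Finset.range (n * m), f x =
      ∑ j ∈ Finset.range m, ∑ a ∈ Finset.range n, f (a + n * j) := by
  induction m with
  | zero => simp
  | succ m ih =>
    rw [Nat.mul_succ, Finset.sum_range_add, ih, Finset.sum_range_succ]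
    simp only [add_comm]

theorem sum_range_pow_succ_sub (f : ℤ_[p] → ℂ_[p]) (N : ℕ) :
    ∑ a ∈ Finset.range (p ^ (N + 1)), f a - p * ∑ a ∈ Finset.range (p ^ N), f a =
      ∑ j ∈ Finset.range p, ∑ a ∈ Finset.range (p ^ N),
        (f ((a : ℤ_[p]) + (p : ℤ_[p]) ^ N * j) - f a) := by
  rw [pow_succ, sum_range_mul_eq]
  simp [Finset.sum_sub_distrib]

theorem norm_p_pow_mul_le (N : ℕ) (x : ℤ_[p]) : ‖(p : ℤ_[p]) ^ N * x‖ ≤ (p : ℝ)⁻¹ ^ N :=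
  norm_le_inv_p_pow_iff_dvd.mpr (dvd_mul_right _ _)

theorem norm_sum_range_pow_le {g : ℤ_[p] → ℂ_[p]} {C : ℝ} (h0 : ‖g 0‖ ≤ C * p)
    (hg : ∀ x h, ‖g (x + h) - g x‖ ≤ C * ‖h‖) (N : ℕ) :
    ‖∑ a ∈ Finset.range (p ^ N), g a‖ ≤ C * p * (p : ℝ)⁻¹ ^ N := by
  have hp : (p : ℝ) ≠ 0 := Nat.cast_ne_zero.mpr (Fact.out : p.Prime).ne_zero
  have hC : 0 ≤ C := by simpa using (norm_nonneg _).trans (hg 0 1)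
  induction N with
  | zero => simpa using h0
  | succ N ih =>
    rw [← sub_add_cancel (∑ a ∈ Finset.range (p ^ (N + 1)), g a)
      (p * ∑ a ∈ Finset.range (p ^ N), g a), sum_range_pow_succ_sub]
    refine (IsUltrametricDist.norm_add_le_max _ _).trans (max_le ?_ ?_)
    · refine IsUltrametricDist.norm_sum_le_of_forall_le_of_nonneg (by positivity) fun j _ =>
        IsUltrametricDist.norm_sum_le_of_forall_le_of_nonneg (by positivity) fun a _ => ?_
      calc _ ≤ C * ‖(p : ℤ_[p]) ^ N * j‖ := hg _ _
        _ ≤ C * (p : ℝ)⁻¹ ^ N := mul_le_mul_of_nonneg_left (norm_p_pow_mul_le N _) hC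
        _ = C * p * (p : ℝ)⁻¹ ^ (N + 1) := by rw [pow_succ]; field_simp
    · calc _ = (p : ℝ)⁻¹ * ‖∑ a ∈ Finset.range (p ^ N), g a‖ := by rw [norm_mul, norm_p]
        _ ≤ (p : ℝ)⁻¹ * (C * p * (p : ℝ)⁻¹ ^ N) := mul_le_mul_of_nonneg_left ih (by positivity)
        _ = C * p * (p : ℝ)⁻¹ ^ (N + 1) := by ring

theorem norm_sum_range_id_le (hp : p ≠ 2) :
    ‖∑ j ∈ Finset.range p, (j : ℂ_[p])‖ ≤ (p : ℝ)⁻¹ := by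
  obtain ⟨m, hm⟩ := (Fact.out : p.Prime).odd_of_ne_two hp
  have gauss : ∑ j ∈ Finset.range p, j = p * m := by
    have htwo := Finset.sum_range_id_mul_two p
    rw [show p - 1 = 2 * m by omega] at htwo
    linarith
  rw [← Nat.cast_sum, gauss, Nat.cast_mul, norm_mul, norm_p]
  exact mul_le_of_le_one_right (by positivity) (IsUltrametricDist.norm_natCast_le_one _ m)

/-- The sums `p⁻ᴺ ∑_{a < p ^ N} f(a)` whose limit is the Volkenborn integral of `f`. -/
noncomputable def volkenbornSum (f : ℤ_[p] → ℂ_[p]) (N : ℕ) : ℂ_[p] :=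
  ((p : ℂ_[p]) ^ N)⁻¹ * ∑ a ∈ Finset.range (p ^ N), f (a : ℤ_[p])

theorem volkenbornSum_succ_sub (f : ℤ_[p] → ℂ_[p]) (N : ℕ) :
    volkenbornSum f (N + 1) - volkenbornSum f N = ((p : ℂ_[p]) ^ (N + 1))⁻¹ *
      ∑ j ∈ Finset.range p, ∑ a ∈ Finset.range (p ^ N),
        (f ((a : ℤ_[p]) + (p : ℤ_[p]) ^ N * j) - f a) := by
  have := p_ne_zero (p := p)
  rw [← sum_range_pow_succ_sub, volkenbornSum, volkenbornSum]
  field_simp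
  ring

namespace HasTaylorBound

variable {R A : ℝ} {f f' : ℤ_[p] → ℂ_[p]}

-- The first-order terms add up to `p ^ N * (∑ j < p, j) * ∑ a < p ^ N, f' a`, and for odd `p` the
-- factor `∑ j < p, j` contributes one more `p`.
theorem norm_sum_increments_le (hf : HasTaylorBound R A f f') (hp : p ≠ 2) (hR : 1 ≤ R) (N : ℕ) :
    ‖∑ j ∈ Finset.range p, ∑ a ∈ Finset.range (p ^ N),
      (f ((a : ℤ_[p]) + (p : ℤ_[p]) ^ N * j) - f a)‖ ≤ A * R ^ 2 * ((p : ℝ)⁻¹ ^ N) ^ 2 := by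
  have hA := hf.nonneg
  have hp0 : (p : ℝ) ≠ 0 := Nat.cast_ne_zero.mpr (Fact.out : p.Prime).ne_zero
  have hf'0 : ‖f' 0‖ ≤ A * R ^ 2 * p := by
    calc ‖f' 0‖ ≤ A * R := hf.norm_deriv_le 0
      _ ≤ A * R ^ 2 := mul_le_mul_of_nonneg_left (le_self_pow₀ hR two_ne_zero) hA
      _ ≤ A * R ^ 2 * p := le_mul_of_one_le_right (by positivity) one_le_p
  have taylor : ∑ j ∈ Finset.range p, ∑ a ∈ Finset.range (p ^ N),
        (f ((a : ℤ_[p]) + (p : ℤ_[p]) ^ N * j) - f a) =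
      ∑ j ∈ Finset.range p, ∑ a ∈ Finset.range (p ^ N),
        (f ((a : ℤ_[p]) + (p : ℤ_[p]) ^ N * j) - f a - f' a * toCp p ((p : ℤ_[p]) ^ N * j)) +
      (p : ℂ_[p]) ^ N * (∑ j ∈ Finset.range p, (j : ℂ_[p])) *
        ∑ a ∈ Finset.range (p ^ N), f' a := by
    simp only [Finset.sum_sub_distrib, ← Finset.sum_mul, map_mul, map_pow, map_natCast,
      ← Finset.mul_sum]
    ring
  rw [taylor]
  refine (IsUltrametricDist.norm_add_le_max _ _).trans (max_le ?_ ?_)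
  · refine IsUltrametricDist.norm_sum_le_of_forall_le_of_nonneg (by positivity) fun j _ =>
      IsUltrametricDist.norm_sum_le_of_forall_le_of_nonneg (by positivity) fun a _ => ?_
    refine (hf.norm_taylor_le _ _).trans ?_
    gcongr
    exact norm_p_pow_mul_le N _
  · calc _ = (p : ℝ)⁻¹ ^ N * ‖∑ j ∈ Finset.range p, (j : ℂ_[p])‖ *
            ‖∑ a ∈ Finset.range (p ^ N), f' a‖ := by rw [norm_mul, norm_mul, norm_pow, norm_p]
      _ ≤ (p : ℝ)⁻¹ ^ N * (p : ℝ)⁻¹ * (A * R ^ 2 * p * (p : ℝ)⁻¹ ^ N) := by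
          gcongr
          · exact norm_sum_range_id_le hp
          · exact norm_sum_range_pow_le hf'0 hf.norm_deriv_sub_le N
      _ = A * R ^ 2 * ((p : ℝ)⁻¹ ^ N) ^ 2 := by field_simp

theorem norm_volkenbornSum_succ_sub_le (hf : HasTaylorBound R A f f') (hp : p ≠ 2) (hR : 1 ≤ R)
    (N : ℕ) :
    ‖volkenbornSum f (N + 1) - volkenbornSum f N‖ ≤ A * R ^ 2 * p * (p : ℝ)⁻¹ ^ N := by
  have hp0 : (p : ℝ) ≠ 0 := Nat.cast_ne_zero.mpr (Fact.out : p.Prime).ne_zero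
  calc _ = (p : ℝ) ^ (N + 1) * _ := by
        rw [volkenbornSum_succ_sub, norm_mul, norm_inv, norm_pow, norm_p, inv_pow, inv_inv]
    _ ≤ (p : ℝ) ^ (N + 1) * (A * R ^ 2 * ((p : ℝ)⁻¹ ^ N) ^ 2) :=
        mul_le_mul_of_nonneg_left (hf.norm_sum_increments_le hp hR N) (by positivity)
    _ = A * R ^ 2 * p * (p : ℝ)⁻¹ ^ N := by rw [inv_pow]; field_simp; ring

theorem tendsto_volkenbornSum (hf : HasTaylorBound R A f f') (hp : p ≠ 2) (hR : 1 ≤ R) :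
    Tendsto (volkenbornSum f) atTop (𝓝 (volkenborn p f)) := by
  refine CauchySeq.tendsto_limUnder
    (cauchySeq_of_le_geometric (p : ℝ)⁻¹ (A * R ^ 2 * p) inv_p_lt_one fun N => ?_)
  rw [dist_comm, dist_eq_norm]
  exact hf.norm_volkenbornSum_succ_sub_le hp hR N

theorem norm_volkenbornSum_le (hf : HasTaylorBound R A f f') (hp : p ≠ 2) (hR : 1 ≤ R) (N : ℕ) :
    ‖volkenbornSum f N‖ ≤ A * R ^ 2 * p := by
  have hA := hf.nonneg
  induction N with
  | zero =>
    have hA1 : A ≤ A * R ^ 2 * p := by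
      rw [mul_assoc]
      exact le_mul_of_one_le_right hA (one_le_mul_of_one_le_of_one_le (one_le_pow₀ hR) one_le_p)
    simpa [volkenbornSum] using (hf.norm_le 0).trans hA1
  | succ N ih =>
    rw [← sub_add_cancel (volkenbornSum f (N + 1)) (volkenbornSum f N)]
    refine (IsUltrametricDist.norm_add_le_max _ _).trans (max_le ?_ ih)
    exact (hf.norm_volkenbornSum_succ_sub_le hp hR N).trans
      (mul_le_of_le_one_right (by positivity) (pow_le_one₀ (by positivity) inv_p_lt_one.le))

theorem norm_volkenborn_le (hf : HasTaylorBound R A f f') (hp : p ≠ 2) (hR : 1 ≤ R) :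
    ‖volkenborn p f‖ ≤ A * R ^ 2 * p :=
  le_of_tendsto (hf.tendsto_volkenbornSum hp hR).norm
    (Eventually.of_forall (hf.norm_volkenbornSum_le hp hR))

end HasTaylorBound

theorem volkenborn_const_mul {f : ℤ_[p] → ℂ_[p]}
    (hf : Tendsto (volkenbornSum f) atTop (𝓝 (volkenborn p f))) (c : ℂ_[p]) :
    volkenborn p (fun a => c * f a) = c * volkenborn p f := by
  refine ((hf.const_mul c).congr fun N => ?_).limUnder_eq
  rw [volkenbornSum, ← Finset.mul_sum, mul_left_comm]

theorem volkenborn_tsum (hp : p ≠ 2) {R : ℝ} (hR : 1 ≤ R) {A : ℕ → ℝ}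
    {F F' : ℕ → ℤ_[p] → ℂ_[p]} (hF : ∀ n, HasTaylorBound R (A n) (F n) (F' n))
    (hA : Summable A) :
    volkenborn p (fun a => ∑' n, F n a) = ∑' n, volkenborn p (F n) := by
  refine Tendsto.limUnder_eq ?_
  have hlim : Tendsto (fun N => ∑' n, volkenbornSum (F n) N) atTop
      (𝓝 (∑' n, volkenborn p (F n))) :=
    tendsto_tsum_of_dominated_convergence (hA.mul_right (R ^ 2 * p))
      (fun n => (hF n).tendsto_volkenbornSum hp hR) (Eventually.of_forall fun N n => by
        simpa only [mul_assoc] using (hF n).norm_volkenbornSum_le hp hR N)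
  refine hlim.congr fun N => ?_
  have hsum (a : ℕ) : Summable fun n => F n (a : ℤ_[p]) :=
    hA.of_norm_bounded fun n => (hF n).norm_le a
  simp only [volkenbornSum]
  rw [Summable.tsum_mul_left _ (summable_sum fun a _ => hsum a),
    Summable.tsum_finsetSum fun a _ => hsum a]

end Volkenborn

section NewtonSeries

/-- The radius `p ^ ((p - 2) / (p - 1))` of the disc of weights `s` on which the series
`⟨x⟩ ^ s = ∑ n, (s choose n) (⟨x⟩ - 1) ^ n` converges. -/
noncomputable def weightRadius (p : ℕ) : ℝ := (p : ℝ) ^ (((p : ℝ) - 2) / ((p : ℝ) - 1))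

theorem weightRadius_pos : 0 < weightRadius p :=
  Real.rpow_pos_of_pos (Nat.cast_pos.mpr (Fact.out : p.Prime).pos) _

theorem one_lt_weightRadius (hp : p ≠ 2) : 1 < weightRadius p := by
  have hp2 : (2 : ℝ) < p :=
    Nat.cast_lt.mpr ((Fact.out : p.Prime).two_le.lt_of_ne' hp)
  exact Real.one_lt_rpow (by linarith) (div_pos (by linarith) (by linarith))

theorem div_weightRadius_pow : ((p : ℝ) / weightRadius p) ^ (p - 1) = p := by
  have hp1 : (1 : ℝ) < p := Nat.one_lt_cast.mpr (Fact.out : p.Prime).one_lt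
  have hp0 : (0 : ℝ) < p := one_pos.trans hp1
  have hroot : (p : ℝ) / weightRadius p = (p : ℝ) ^ (((p - 1 : ℕ) : ℝ)⁻¹) := by
    rw [weightRadius, div_eq_iff (Real.rpow_pos_of_pos hp0 _).ne', ← Real.rpow_add hp0,
      Nat.cast_sub (Fact.out : p.Prime).one_le, Nat.cast_one, inv_eq_one_div, ← add_div,
      show 1 + ((p : ℝ) - 2) = p - 1 by ring, div_self (sub_pos.mpr hp1).ne', Real.rpow_one]
  rw [hroot, Real.rpow_inv_natCast_pow hp0.le
    (Nat.sub_pos_of_lt (Fact.out : p.Prime).one_lt).ne']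

-- Legendre's formula bounds the `p`-adic valuation of `n !` by `n / (p - 1)`.
theorem norm_inv_factorial_le (n : ℕ) :
    ‖(n.factorial : ℂ_[p])⁻¹‖ ≤ ((p : ℝ) / weightRadius p) ^ n := by
  have hp : p.Prime := Fact.out
  have hr := weightRadius_pos (p := p)
  have hval : padicValNat p n.factorial * (p - 1) ≤ n := by
    have := sub_one_mul_padicValNat_factorial (p := p) n
    rw [mul_comm]
    omega
  have hnorm : ‖(n.factorial : ℂ_[p])⁻¹‖ = (p : ℝ) ^ padicValNat p n.factorial := by
    rw [norm_inv, norm_natCast, PadicInt.norm_eq_zpow_neg_valuation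
      (Nat.cast_ne_zero.mpr n.factorial_ne_zero), zpow_neg, inv_inv, ← PadicInt.valuation_coe,
      PadicInt.coe_natCast, Padic.valuation_natCast, zpow_natCast]
  refine (pow_le_pow_iff_left₀ (norm_nonneg _) (by positivity)
    (Nat.sub_pos_of_lt hp.one_lt).ne').mp ?_
  rw [hnorm, ← pow_mul, ← pow_mul, mul_comm n, pow_mul _ _ n, div_weightRadius_pow]
  exact pow_le_pow_right₀ one_le_p hval

/-- The polynomial `(s choose (n + 1)) / s` in `s`. -/
noncomputable def binomQuot (s : ℂ_[p]) (n : ℕ) : ℂ_[p] :=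
  (∏ i ∈ Finset.range n, (s - ((i + 1 : ℕ) : ℂ_[p]))) / ((n + 1).factorial : ℂ_[p])

theorem choose_succ_eq_mul_binomQuot (s : ℂ_[p]) (n : ℕ) :
    Ring.choose s (n + 1) = s * binomQuot s n := by
  have hfac : ((n + 1).factorial : ℂ_[p]) ≠ 0 := Nat.cast_ne_zero.mpr (n + 1).factorial_ne_zero
  have hprod : (descPochhammer ℤ (n + 1)).smeval s = ∏ i ∈ Finset.range (n + 1), (s - i) := by
    rw [← descPochhammer_eval_eq_prod_range, ← Polynomial.aeval_eq_smeval, Polynomial.aeval_def,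
      Polynomial.eval₂_eq_eval_map, descPochhammer_map]
  have hchoose := Ring.descPochhammer_eq_factorial_smul_choose s (n + 1)
  rw [hprod, Finset.prod_range_succ', nsmul_eq_mul, Nat.cast_zero, sub_zero] at hchoose
  rw [binomQuot, mul_div_assoc', eq_div_iff hfac, mul_comm, ← hchoose, mul_comm]

theorem continuous_binomQuot (n : ℕ) : Continuous fun s : ℂ_[p] => binomQuot s n := by
  unfold binomQuot
  fun_prop

theorem norm_binomQuot_le {ρ : ℝ} (hρ : 1 ≤ ρ) {s : ℂ_[p]} (hs : ‖s‖ ≤ ρ) (n : ℕ) :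
    ‖binomQuot s n‖ ≤ ρ ^ n * ((p : ℝ) / weightRadius p) ^ (n + 1) := by
  rw [binomQuot, div_eq_mul_inv, norm_mul]
  refine mul_le_mul ?_ (norm_inv_factorial_le (n + 1)) (norm_nonneg _) (by positivity)
  rw [norm_prod]
  refine (Finset.prod_le_prod (fun _ _ => norm_nonneg _) fun i _ => ?_).trans_eq
    (by rw [Finset.prod_const, Finset.card_range])
  exact (norm_sub_le_max _ _).trans
    (max_le hs ((IsUltrametricDist.norm_natCast_le_one _ _).trans hρ))

variable {M : ℕ → ℂ_[p]} {C : ℝ} {s : ℂ_[p]}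

theorem norm_binomQuot_mul_le (hM : ∀ n, ‖M n‖ ≤ C * (p : ℝ)⁻¹ ^ n) {ρ : ℝ} (hρ : 1 ≤ ρ)
    (hs : ‖s‖ ≤ ρ) (n : ℕ) :
    ‖binomQuot s n * M (n + 1)‖ ≤ C * (ρ / weightRadius p) ^ (n + 1) := by
  have hp0 : (p : ℝ) ≠ 0 := Nat.cast_ne_zero.mpr (Fact.out : p.Prime).ne_zero
  have hr := weightRadius_pos (p := p)
  have hC : 0 ≤ C := by simpa using (norm_nonneg _).trans (hM 0)
  calc _ ≤ ρ ^ n * ((p : ℝ) / weightRadius p) ^ (n + 1) * (C * (p : ℝ)⁻¹ ^ (n + 1)) := by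
        rw [norm_mul]
        exact mul_le_mul (norm_binomQuot_le hρ hs n) (hM _) (norm_nonneg _) (by positivity)
    _ ≤ ρ ^ (n + 1) * ((p : ℝ) / weightRadius p) ^ (n + 1) * (C * (p : ℝ)⁻¹ ^ (n + 1)) := by
        gcongr
        exact n.le_succ
    _ = C * (ρ / weightRadius p) ^ (n + 1) := by
        rw [div_pow, div_pow, inv_pow]
        field_simp

theorem summable_div_weightRadius_pow_succ {ρ : ℝ} (hρ : 1 ≤ ρ) (hρr : ρ < weightRadius p) :
    Summable fun n : ℕ => C * (ρ / weightRadius p) ^ (n + 1) := by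
  have hr := weightRadius_pos (p := p)
  exact ((summable_nat_add_iff 1).mpr
    (summable_geometric_of_lt_one (by positivity) ((div_lt_one hr).mpr hρr))).mul_left C

variable (M) in
/-- The Newton interpolation series `∑ n, (s choose n) M_n`. -/
noncomputable def newtonSeries (s : ℂ_[p]) : ℂ_[p] := ∑' n, Ring.choose s n * M n

variable (M) in
/-- The quotient of `newtonSeries M s - M 0` by `s`. -/
noncomputable def newtonQuot (s : ℂ_[p]) : ℂ_[p] := ∑' n, binomQuot s n * M (n + 1)

theorem summable_norm_newtonQuot (hp : p ≠ 2) (hM : ∀ n, ‖M n‖ ≤ C * (p : ℝ)⁻¹ ^ n)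
    (hs : ‖s‖ < weightRadius p) : Summable fun n => ‖binomQuot s n * M (n + 1)‖ :=
  (summable_div_weightRadius_pow_succ (le_max_left 1 ‖s‖)
    (max_lt (one_lt_weightRadius hp) hs)).of_nonneg_of_le (fun _ => norm_nonneg _)
    (norm_binomQuot_mul_le hM (le_max_left _ _) (le_max_right _ _))

theorem choose_succ_mul_eq (n : ℕ) :
    Ring.choose s (n + 1) * M (n + 1) = s * (binomQuot s n * M (n + 1)) := by
  rw [choose_succ_eq_mul_binomQuot, mul_assoc]

theorem summable_norm_newtonSeries (hp : p ≠ 2) (hM : ∀ n, ‖M n‖ ≤ C * (p : ℝ)⁻¹ ^ n)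
    (hs : ‖s‖ < weightRadius p) : Summable fun n => ‖Ring.choose s n * M n‖ := by
  rw [← summable_nat_add_iff 1]
  simpa only [choose_succ_mul_eq, norm_mul s] using
    (summable_norm_newtonQuot hp hM hs).mul_left ‖s‖

theorem newtonSeries_eq_add_mul_newtonQuot (hp : p ≠ 2) (hM : ∀ n, ‖M n‖ ≤ C * (p : ℝ)⁻¹ ^ n)
    (hs : ‖s‖ < weightRadius p) : newtonSeries M s = M 0 + s * newtonQuot M s := by
  rw [newtonSeries, (summable_norm_newtonSeries hp hM hs).of_norm.tsum_eq_zero_add, newtonQuot,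
    ← (summable_norm_newtonQuot hp hM hs).of_norm.tsum_mul_left]
  simp only [choose_succ_mul_eq, Ring.choose_zero_right, one_mul]

theorem continuousAt_newtonQuot (hp : p ≠ 2) (hM : ∀ n, ‖M n‖ ≤ C * (p : ℝ)⁻¹ ^ n)
    (hs : ‖s‖ < weightRadius p) : ContinuousAt (newtonQuot M) s := by
  obtain ⟨ρ, hρ, hρr⟩ := exists_between (max_lt (one_lt_weightRadius hp) hs)
  obtain ⟨hρ1, hρs⟩ := max_lt_iff.mp hρ
  have hcont : ContinuousOn (newtonQuot M) {t | ‖t‖ ≤ ρ} :=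
    continuousOn_tsum (fun n => ((continuous_binomQuot n).mul_const _).continuousOn)
      (summable_div_weightRadius_pow_succ hρ1.le hρr) fun n _ ht =>
        norm_binomQuot_mul_le hM hρ1.le ht n
  refine hcont.continuousAt ?_
  filter_upwards [continuous_norm.tendsto s |>.eventually_lt_const hρs] with t ht using ht.le

theorem norm_newtonSeries_sub_le (hp : p ≠ 2) (hM : ∀ n, ‖M n‖ ≤ C * (p : ℝ)⁻¹ ^ n)
    (hs : ‖s‖ ≤ 1) : ‖newtonSeries M s - M 0‖ ≤ C * ‖s‖ := by
  have hC : 0 ≤ C := by simpa using (norm_nonneg _).trans (hM 0)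
  have hr := one_lt_weightRadius hp
  have hsr := hs.trans_lt hr
  have hquot : ‖newtonQuot M s‖ ≤ C := by
    refine (IsUltrametricDist.norm_tsum_le _).trans (ciSup_le fun n => ?_)
    refine (norm_binomQuot_mul_le hM le_rfl hs n).trans (mul_le_of_le_one_right hC ?_)
    exact pow_le_one₀ (by positivity) ((div_le_one weightRadius_pos).mpr hr.le)
  rw [newtonSeries_eq_add_mul_newtonQuot hp hM hsr, add_sub_cancel_left, norm_mul, mul_comm]
  exact mul_le_mul_of_nonneg_right hquot (norm_nonneg s)

end NewtonSeries

section AngleMoments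

/-- The function `⟨x⟩ - 1` on the units, extended by zero to `p ℤ_p`; its Taylor constant is
`p⁻¹`, which makes the Newton series of `⟨x⟩ ^ s` converge. -/
noncomputable def angleSubOne (x : ℤ_[p]) : ℂ_[p] :=
  open Classical in if IsUnit x then angle p x - 1 else 0

/-- The derivative of `angleSubOne`. -/
noncomputable def angleSubOneDeriv (x : ℤ_[p]) : ℂ_[p] :=
  open Classical in if IsUnit x then (toCp p (teich p x))⁻¹ else 0

theorem hasTaylorBound_angleSubOne {v : ℕ} (hv : v ≠ 0) :
    HasTaylorBound ((p : ℝ) ^ v) (p : ℝ)⁻¹ (angleSubOne (p := p)) angleSubOneDeriv := by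
  have hpv : (1 : ℝ) ≤ (p : ℝ)⁻¹ * (p : ℝ) ^ v := by
    rw [← pow_sub_one_mul hv, mul_comm (_ ^ _),
      inv_mul_cancel_left₀ (Nat.cast_ne_zero.mpr (Fact.out : p.Prime).ne_zero)]
    exact one_le_pow₀ one_le_p
  refine HasTaylorBound.of_locally_affine (fun x => ?_) (fun x => ?_) (fun x h hh => ?_)
    fun x h hh => ?_
  · rw [angleSubOne]
    split_ifs with hx
    · exact norm_angle_sub_one_le hx
    · simp
  · rw [angleSubOneDeriv]
    split_ifs with hx
    · rwa [norm_inv, norm_toCp_teich hx, inv_one]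
    · rw [norm_zero]
      positivity
  · have hh' := (dvd_pow_self (p : ℤ_[p]) hv).trans hh
    by_cases hx : IsUnit x
    · rw [angleSubOne, angleSubOne, angleSubOneDeriv, if_pos hx, if_pos hx,
        if_pos ((isUnit_add_iff hh').mpr hx), angle_add hx hh']
      ring
    · rw [angleSubOne, angleSubOne, angleSubOneDeriv, if_neg hx, if_neg hx,
        if_neg (mt (isUnit_add_iff hh').mp hx), zero_mul, zero_add]
  · have hh' := (dvd_pow_self (p : ℤ_[p]) hv).trans hh
    have hteich : teich p (x + h) = teich p x := teich_congr (by simpa using hh')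
    by_cases hx : IsUnit x
    · rw [angleSubOneDeriv, angleSubOneDeriv, if_pos hx, if_pos ((isUnit_add_iff hh').mpr hx),
        hteich]
    · rw [angleSubOneDeriv, angleSubOneDeriv, if_neg hx,
        if_neg (mt (isUnit_add_iff hh').mp hx)]

variable {v : ℕ} (χ : DirichletCharacter ℂ_[p] (p ^ v)) (x : ℤ_[p])

theorem hasTaylorBound_charEval :
    HasTaylorBound ((p : ℝ) ^ v) 1 (charEval p χ) (fun _ => 0) :=
  .of_locally_affine (norm_charEval_le_one χ) (by simp)
    (fun y h hh => by rw [charEval_add χ hh, zero_mul, add_zero]) (by simp)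

theorem charEval_mul_angle_sub_one_pow (hv : v ≠ 0) (y : ℤ_[p]) (n : ℕ) :
    charEval p χ y * (angle p y - 1) ^ n = charEval p χ y * angleSubOne y ^ n := by
  by_cases hy : IsUnit y
  · rw [angleSubOne, if_pos hy]
  · rw [charEval_of_not_isUnit χ hv hy, zero_mul, zero_mul]

theorem exists_hasTaylorBound_charEval_mul_pow (hv : v ≠ 0) (n : ℕ) :
    ∃ f', HasTaylorBound ((p : ℝ) ^ v) ((p : ℝ)⁻¹ ^ n)
      (fun a => charEval p χ (x + a) * (angle p (x + a) - 1) ^ n) f' := by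
  have hR : (0 : ℝ) ≤ (p : ℝ) ^ v := by positivity
  simp only [charEval_mul_angle_sub_one_pow χ hv]
  have h := ((hasTaylorBound_charEval χ).mul ((hasTaylorBound_angleSubOne hv).pow hR n)
    hR).comp_add_left x
  rw [one_mul] at h
  exact ⟨_, h⟩

/-- The Volkenborn integral of `χ(x + a) (⟨x + a⟩ - 1) ^ n`. -/
noncomputable def angleMoment (n : ℕ) : ℂ_[p] :=
  volkenborn p fun a => charEval p χ (x + a) * (angle p (x + a) - 1) ^ n

theorem one_le_p_pow : (1 : ℝ) ≤ (p : ℝ) ^ v :=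
  one_le_pow₀ one_le_p

theorem norm_angleMoment_le (hp : p ≠ 2) (hv : v ≠ 0) (n : ℕ) :
    ‖angleMoment χ x n‖ ≤ ((p : ℝ) ^ v) ^ 2 * p * (p : ℝ)⁻¹ ^ n := by
  obtain ⟨f', hf⟩ := exists_hasTaylorBound_charEval_mul_pow χ x hv n
  exact (hf.norm_volkenborn_le hp one_le_p_pow).trans_eq (by ring)

theorem charEval_mul_anglePow (s : ℂ_[p]) (y : ℤ_[p]) :
    charEval p χ y * anglePow p y s =
      ∑' n, Ring.choose s n * (charEval p χ y * (angle p y - 1) ^ n) := by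
  rw [anglePow, ← tsum_mul_left]
  simp only [mul_left_comm]

theorem volkenborn_charEval_mul_anglePow (hp : p ≠ 2) (hv : v ≠ 0) {s : ℂ_[p]}
    (hs : ‖s‖ < weightRadius p) :
    volkenborn p (fun a => charEval p χ (x + a) * anglePow p (x + a) s) =
      newtonSeries (angleMoment χ x) s := by
  have hR : (1 : ℝ) ≤ (p : ℝ) ^ v := one_le_p_pow
  choose f' hf using exists_hasTaylorBound_charEval_mul_pow χ x hv
  have hsum : Summable fun n => ‖Ring.choose s n‖ * (p : ℝ)⁻¹ ^ n := by
    simpa only [norm_mul, norm_pow, norm_p] using summable_norm_newtonSeries hp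
      (M := fun n => (p : ℂ_[p]) ^ n) (C := 1) (fun n => by rw [norm_pow, norm_p, one_mul]) hs
  simp only [charEval_mul_anglePow]
  rw [volkenborn_tsum hp hR (fun n => (hf n).const_mul (zero_le_one.trans hR) _) hsum]
  refine tsum_congr fun n => ?_
  exact volkenborn_const_mul ((hf n).tendsto_volkenbornSum hp hR) _

theorem sum_range_charEval_add :
    ∑ a ∈ Finset.range (p ^ v), charEval p χ (x + a) = ∑ b, χ b := by
  rw [← Equiv.sum_comp (Equiv.addLeft (PadicInt.toZModPow v x))]
  refine Finset.sum_nbij' (fun a => (a : ZMod (p ^ v))) ZMod.val (fun _ _ => Finset.mem_univ _)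
    (fun a _ => ?_) (fun a ha => ?_) (fun a _ => ZMod.natCast_zmod_val a) (fun a _ => ?_)
  · simpa using ZMod.val_lt a
  · exact ZMod.val_cast_of_lt (by simpa using ha)
  · rw [charEval, map_add, map_natCast]
    rfl

variable {χ} in
theorem angleMoment_zero (hχ : χ ≠ 1) : angleMoment χ x 0 = 0 := by
  refine (tendsto_const_nhds.congr' ?_).limUnder_eq
  filter_upwards [eventually_ge_atTop v] with N hN
  obtain ⟨m, rfl⟩ := Nat.exists_eq_add_of_le hN
  have hperiod (a j : ℕ) : charEval p χ (x + (a + p ^ v * j : ℕ)) = charEval p χ (x + a) := by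
    rw [Nat.cast_add, Nat.cast_mul, Nat.cast_pow, ← add_assoc, charEval_add χ (dvd_mul_right _ _)]
  simp only [pow_zero, mul_one]
  rw [pow_add p, sum_range_mul_eq]
  simp only [hperiod, sum_range_charEval_add, MulChar.sum_eq_zero_of_ne_one hχ,
    Finset.sum_const_zero, mul_zero]

end AngleMoments

section Zeta

variable {v : ℕ} {χ : DirichletCharacter ℂ_[p] (p ^ v)} {x : ℤ_[p]} {s : ℂ_[p]}

theorem hurwitzZetaAux_one_sub (hp : p ≠ 2) (hv : v ≠ 0) (hs : ‖s‖ < weightRadius p)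
    (hs0 : s ≠ 0) :
    hurwitzZetaAux p (1 - s) χ x =
      -(angleMoment χ x 0 / s + newtonQuot (angleMoment χ x) s) := by
  rw [hurwitzZetaAux, sub_sub_cancel, sub_sub_cancel_left,
    volkenborn_charEval_mul_anglePow χ x hp hv hs,
    newtonSeries_eq_add_mul_newtonQuot hp (norm_angleMoment_le χ x hp hv) hs]
  field_simp

theorem hurwitzZeta_one (hp : p ≠ 2) (hv : v ≠ 0) (hχ : χ ≠ 1) :
    hurwitzZeta p 1 χ x = -newtonQuot (angleMoment χ x) 0 := by
  have hr : ‖(0 : ℂ_[p])‖ < weightRadius p := by simpa using weightRadius_pos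
  rw [hurwitzZeta, if_pos rfl]
  refine Tendsto.limUnder_eq ?_
  have hsub : Tendsto (fun t : ℂ_[p] => 1 - t) (𝓝[≠] 1) (𝓝 0) := by
    have hcont : Continuous fun t : ℂ_[p] => 1 - t := by fun_prop
    simpa using (hcont.tendsto 1).mono_left nhdsWithin_le_nhds
  refine ((continuousAt_newtonQuot hp (norm_angleMoment_le χ x hp hv) hr).tendsto.comp
    hsub).neg.congr' ?_
  filter_upwards [hsub.norm.eventually_lt_const hr, self_mem_nhdsWithin] with t ht ht1
  have haux := hurwitzZetaAux_one_sub (χ := χ) (x := x) hp hv ht (sub_ne_zero.mpr (Ne.symm ht1))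
  rw [sub_sub_cancel, angleMoment_zero x hχ, zero_div, zero_add] at haux
  exact haux.symm

theorem hurwitzZeta_one_sub (hp : p ≠ 2) (hv : v ≠ 0) (hs : ‖s‖ < weightRadius p)
    (h : s ≠ 0 ∨ χ ≠ 1) :
    hurwitzZeta p (1 - s) χ x =
      -(angleMoment χ x 0 / s + newtonQuot (angleMoment χ x) s) := by
  by_cases hs0 : s = 0
  · rw [hs0, sub_zero, div_zero, zero_add, hurwitzZeta_one hp hv (h.resolve_left (not_not.mpr hs0))]
  · rw [hurwitzZeta, if_neg (by simpa using hs0), hurwitzZetaAux_one_sub hp hv hs hs0]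

theorem continuousAt_hurwitzZeta_one_sub (hp : p ≠ 2) (hv : v ≠ 0) (hs : ‖s‖ < weightRadius p)
    (h : s ≠ 0 ∨ χ ≠ 1) : ContinuousAt (fun t => hurwitzZeta p (1 - t) χ x) s := by
  have hquot := continuousAt_newtonQuot hp (norm_angleMoment_le χ x hp hv) hs
  have hpole : ContinuousAt (fun t => angleMoment χ x 0 / t) s := by
    rcases h with hs0 | hχ
    · exact continuousAt_const.div continuousAt_id hs0
    · simpa [angleMoment_zero x hχ] using continuousAt_const
  have hnear : ∀ᶠ t in 𝓝 s, t ≠ 0 ∨ χ ≠ 1 := by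
    rcases h with hs0 | hχ
    · filter_upwards [isOpen_ne.mem_nhds hs0] with t ht using Or.inl ht
    · exact Eventually.of_forall fun _ => Or.inr hχ
  refine (hpole.add hquot).neg.congr ?_
  filter_upwards [hnear, (continuous_norm.tendsto s).eventually_lt_const hs] with t ht htr
  exact (hurwitzZeta_one_sub hp hv htr ht).symm

end Zeta

section SpecialValues

variable (p) in
theorem tendsto_sum_range_pow_bernoulli (k : ℕ) :
    Tendsto (fun N : ℕ => ((p : ℂ_[p]) ^ N)⁻¹ * ∑ a ∈ Finset.range (p ^ N), (a : ℂ_[p]) ^ k)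
      atTop (𝓝 ((bernoulli k : ℚ) : ℂ_[p])) := by
  have hk : (k : ℂ_[p]) + 1 ≠ 0 := Nat.cast_add_one_ne_zero k
  have hterm : ∀ i ∈ Finset.range (k + 1), Tendsto (fun N : ℕ => ((bernoulli i : ℚ) : ℂ_[p]) *
      ((k + 1).choose i : ℂ_[p]) / ((k : ℂ_[p]) + 1) * ((p : ℂ_[p]) ^ N) ^ (k - i)) atTop
      (𝓝 (if i = k then ((bernoulli k : ℚ) : ℂ_[p]) else 0)) := by
    intro i hi
    split_ifs with hik
    · simp [hik, hk]
    · have hpos : k - i ≠ 0 := by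
        have := Finset.mem_range.mp hi
        omega
      simpa [hpos] using (tendsto_p_pow.pow (k - i)).const_mul (((bernoulli i : ℚ) : ℂ_[p]) *
        ((k + 1).choose i : ℂ_[p]) / ((k : ℂ_[p]) + 1))
  have hsum := tendsto_finsetSum _ hterm
  rw [Finset.sum_ite_eq' (Finset.range (k + 1)) k, if_pos (by simp)] at hsum
  refine hsum.congr fun N => ?_
  have faulhaber := congrArg (Rat.cast : ℚ → ℂ_[p]) (sum_range_pow (p ^ N) k)
  push_cast at faulhaber
  rw [faulhaber, Finset.mul_sum]
  refine Finset.sum_congr rfl fun i hi => ?_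
  rw [Nat.sub_add_comm (Finset.mem_range_succ_iff.mp hi)]
  have hp0 : (p : ℂ_[p]) ≠ 0 := p_ne_zero
  field_simp
  ring

theorem sum_range_pow_succ_of_dvd (k N : ℕ) :
    ∑ a ∈ Finset.range (p ^ (N + 1)), (if p ∣ a then (a : ℂ_[p]) ^ k else 0) =
      p ^ k * ∑ b ∈ Finset.range (p ^ N), (b : ℂ_[p]) ^ k := by
  rw [pow_succ', sum_range_mul_eq, Finset.mul_sum]
  refine Finset.sum_congr rfl fun j _ => ?_
  rw [Finset.sum_eq_single_of_mem 0 (Finset.mem_range.mpr (Fact.out : p.Prime).pos)]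
  · simp [mul_pow]
  · intro a ha ha0
    refine if_neg fun h => ha0 (Nat.eq_zero_of_dvd_of_lt ?_ (Finset.mem_range.mp ha))
    exact (Nat.dvd_add_left (dvd_mul_right p j)).mp h

theorem sum_range_pow_succ_of_not_dvd (k N : ℕ) :
    ∑ a ∈ Finset.range (p ^ (N + 1)), (if p ∣ a then 0 else (a : ℂ_[p]) ^ k) =
      ∑ a ∈ Finset.range (p ^ (N + 1)), (a : ℂ_[p]) ^ k -
        p ^ k * ∑ b ∈ Finset.range (p ^ N), (b : ℂ_[p]) ^ k := by
  rw [← sum_range_pow_succ_of_dvd, ← Finset.sum_sub_distrib]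
  refine Finset.sum_congr rfl fun a _ => ?_
  split_ifs <;> simp

theorem anglePow_natCast (x : ℤ_[p]) (k : ℕ) : anglePow p x (k : ℂ_[p]) = angle p x ^ k := by
  rw [anglePow, tsum_eq_sum (s := Finset.range (k + 1))]
  · conv_rhs => rw [← sub_add_cancel (angle p x) 1, add_pow]
    refine Finset.sum_congr rfl fun n _ => ?_
    rw [Ring.choose_natCast, one_pow, mul_one, mul_comm]
  · intro n hn
    rw [Ring.choose_natCast, Nat.choose_eq_zero_of_lt (by simpa using hn), Nat.cast_zero, zero_mul]

variable {u : ZMod (p - 1)} {k : ℕ}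

theorem charEval_mul_anglePow_natCast (hk : (k : ZMod (p - 1)) = u) {a : ℕ} (ha : p.Coprime a) :
    charEval p (omegaPow p u) (a : ℤ_[p]) * anglePow p (a : ℤ_[p]) (k : ℂ_[p]) =
      (a : ℂ_[p]) ^ k := by
  have := neZero_p_sub_one (p := p)
  have hunit : IsUnit (a : ℤ_[p]) := isUnit_natCast_iff.mpr ha
  have hu : (u.val : ZMod (p - 1)) = k := by rw [ZMod.natCast_zmod_val, hk]
  rw [charEval_omegaPow u ha, teich_pow_congr hunit hu, anglePow_natCast, map_pow, ← mul_pow,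
    toCp_teich_mul_angle hunit, map_natCast]

theorem charEval_mul_anglePow_natCast_eq_ite (hk : (k : ZMod (p - 1)) = u) (a : ℕ) :
    charEval p (omegaPow p u) (a : ℤ_[p]) * anglePow p (a : ℤ_[p]) (k : ℂ_[p]) =
      if p ∣ a then 0 else (a : ℂ_[p]) ^ k := by
  have hcop : p.Coprime a ↔ ¬p ∣ a := Nat.Prime.coprime_iff_not_dvd Fact.out
  split_ifs with h
  · rw [charEval_of_not_isUnit _ one_ne_zero (by rwa [isUnit_natCast_iff, hcop, not_not]), zero_mul]
  · exact charEval_mul_anglePow_natCast hk (hcop.mpr h)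

theorem volkenborn_charEval_mul_anglePow_natCast (hk0 : k ≠ 0) (hk : (k : ZMod (p - 1)) = u) :
    volkenborn p (fun a => charEval p (omegaPow p u) a * anglePow p a (k : ℂ_[p])) =
      (1 - (p : ℂ_[p]) ^ (k - 1)) * ((bernoulli k : ℚ) : ℂ_[p]) := by
  obtain ⟨m, rfl⟩ := Nat.exists_eq_succ_of_ne_zero hk0
  have hlim := tendsto_sum_range_pow_bernoulli p (m + 1)
  refine ((tendsto_add_atTop_iff_nat 1).mp ?_).limUnder_eq
  rw [sub_mul, one_mul]
  refine (((tendsto_add_atTop_iff_nat 1).mpr hlim).sub (hlim.const_mul _)).congr fun N => ?_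
  have hp0 : (p : ℂ_[p]) ≠ 0 := p_ne_zero
  simp only [charEval_mul_anglePow_natCast_eq_ite hk, sum_range_pow_succ_of_not_dvd,
    Nat.succ_eq_add_one, Nat.add_sub_cancel]
  field_simp
  ring

theorem hurwitzZeta_one_sub_natCast (hk0 : k ≠ 0) (hk : (k : ZMod (p - 1)) = u) :
    hurwitzZeta p (1 - k) (omegaPow p u) 0 =
      -((1 - (p : ℂ_[p]) ^ (k - 1)) * ((bernoulli k : ℚ) : ℂ_[p]) / k) := by
  rw [hurwitzZeta, if_neg (by simpa using hk0), hurwitzZetaAux, sub_sub_cancel,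
    sub_sub_cancel_left]
  simp only [zero_add]
  rw [volkenborn_charEval_mul_anglePow_natCast hk0 hk]
  ring

end SpecialValues

section HigherCoefficients

theorem mem_coset_iff_of_lt {a d N : ℕ} (ha : a < p ^ N) (hd : d < p ^ N) :
    (d : ℤ_[p]) ∈ coset p (a : ℤ_[p]) N ↔ a = d := by
  have hdvd := PadicInt.pow_p_dvd_int_iff (p := p) N ((d : ℤ) - a)
  push_cast at hdvd
  rw [coset, Set.mem_ofPred_eq, hdvd]
  refine ⟨fun h => ?_, fun h => by simp [h]⟩
  exact Nat.ModEq.eq_of_lt_of_lt (Nat.modEq_iff_dvd.mpr (by exact_mod_cast h)) ha hd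

theorem sum_range_mul_delta_coset (f : ℤ_[p] → ℂ_[p]) {d N : ℕ} (hd : d < p ^ N) :
    ∑ a ∈ Finset.range (p ^ N), f a * delta p (d : ℤ_[p]) (coset p (a : ℤ_[p]) N) = f d := by
  rw [Finset.sum_eq_single_of_mem d (Finset.mem_range.mpr hd)]
  · rw [delta, if_pos ((mem_coset_iff_of_lt hd hd).mpr rfl), mul_one]
  · intro a ha had
    rw [delta, if_neg (mt (mem_coset_iff_of_lt (Finset.mem_range.mp ha) hd).mp had), mul_zero]

theorem measureIntegral_mu (n : ℕ) (f : ℤ_[p] → ℂ_[p]) :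
    measureIntegral p (mu p n) f =
      ∑ d ∈ n.divisors with p.Coprime d, (d : ℂ_[p])⁻¹ * f (d : ℤ_[p]) := by
  refine (tendsto_const_nhds.congr' ?_).limUnder_eq
  filter_upwards [eventually_ge_atTop n] with N hN
  simp only [mu, Finset.mul_sum, mul_left_comm (f _)]
  rw [Finset.sum_comm]
  refine Finset.sum_congr rfl fun d hd => ?_
  have hdn : d ≤ n := Nat.divisor_le (Finset.mem_filter.mp hd).1
  rw [← Finset.mul_sum, sum_range_mul_delta_coset f
    ((hdn.trans hN).trans_lt (Nat.lt_pow_self (Fact.out : p.Prime).one_lt))]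

theorem familyCoeff_of_ne_zero {v : ℕ} (s : ℂ_[p]) (χ : DirichletCharacter ℂ_[p] (p ^ v))
    (x : ℤ_[p]) {n : ℕ} (hn : n ≠ 0) :
    familyCoeff p s χ x n = ∑ d ∈ n.divisors with p.Coprime d,
      (d : ℂ_[p])⁻¹ * (charEval p χ (x + d) * anglePow p (x + d) s) := by
  rw [familyCoeff, if_neg hn, measureIntegral_mu]

variable {s t : ℂ_[p]}

theorem norm_angle_sub_one_pow_le {x : ℤ_[p]} (hx : IsUnit x) (n : ℕ) :
    ‖(angle p x - 1) ^ n‖ ≤ 1 * (p : ℝ)⁻¹ ^ n := by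
  rw [norm_pow, one_mul]
  exact pow_le_pow_left₀ (norm_nonneg _) (norm_angle_sub_one_le hx) n

theorem anglePow_add (hp : p ≠ 2) {x : ℤ_[p]} (hx : IsUnit x) (hs : ‖s‖ < weightRadius p)
    (ht : ‖t‖ < weightRadius p) :
    anglePow p x (s + t) = anglePow p x s * anglePow p x t := by
  have hM := norm_angle_sub_one_pow_le hx
  rw [anglePow, anglePow, anglePow, tsum_mul_tsum_eq_tsum_sum_antidiagonal_of_summable_norm
    (summable_norm_newtonSeries hp hM hs) (summable_norm_newtonSeries hp hM ht)]
  refine tsum_congr fun n => ?_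
  rw [Ring.add_choose_eq n (Commute.all s t), Finset.sum_mul]
  refine Finset.sum_congr rfl fun ij hij => ?_
  rw [← Finset.HasAntidiagonal.mem_antidiagonal.mp hij, pow_add]
  ring

theorem norm_anglePow_sub_one_le (hp : p ≠ 2) {x : ℤ_[p]} (hx : IsUnit x) (hs : ‖s‖ ≤ 1) :
    ‖anglePow p x s - 1‖ ≤ ‖s‖ := by
  have h := norm_newtonSeries_sub_le hp (norm_angle_sub_one_pow_le hx) hs
  rwa [pow_zero, one_mul] at h

theorem norm_anglePow_sub_le (hp : p ≠ 2) {x : ℤ_[p]} (hx : IsUnit x) (hs : ‖s‖ ≤ 1)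
    (ht : ‖t‖ ≤ 1) : ‖anglePow p x t - anglePow p x s‖ ≤ ‖t - s‖ := by
  have hts : ‖t - s‖ ≤ 1 := (norm_sub_le_max t s).trans (max_le ht hs)
  have hr := one_lt_weightRadius hp
  have hone : ‖anglePow p x s‖ ≤ 1 := by
    rw [← sub_add_cancel (anglePow p x s) 1]
    refine (IsUltrametricDist.norm_add_le_max _ _).trans (max_le ?_ norm_one.le)
    exact (norm_anglePow_sub_one_le hp hx hs).trans hs
  calc _ = ‖anglePow p x s * (anglePow p x (t - s) - 1)‖ := by
        rw [mul_sub_one, ← anglePow_add hp hx (hs.trans_lt hr) (hts.trans_lt hr), add_sub_cancel]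
    _ ≤ 1 * ‖t - s‖ := by
        rw [norm_mul]
        exact mul_le_mul hone (norm_anglePow_sub_one_le hp hx hts) (norm_nonneg _) zero_le_one
    _ = ‖t - s‖ := one_mul _

variable {u : ZMod (p - 1)} {k : ℕ}

theorem norm_pow_sub_charEval_mul_anglePow_le (hp : p ≠ 2) (hs : ‖s‖ ≤ 1) (hk0 : k ≠ 0)
    (hk : (k : ZMod (p - 1)) = u) {d : ℕ} (hd : p.Coprime d) :
    ‖(d : ℂ_[p]) ^ (k - 1) -
      (d : ℂ_[p])⁻¹ * (charEval p (omegaPow p u) d * anglePow p d s)‖ ≤ ‖(k : ℂ_[p]) - s‖ := by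
  have hunit : IsUnit (d : ℤ_[p]) := isUnit_natCast_iff.mpr hd
  have hd1 : ‖(d : ℂ_[p])‖ = 1 := by rw [norm_natCast, PadicInt.isUnit_iff.mp hunit]
  have hd0 : (d : ℂ_[p]) ≠ 0 := norm_ne_zero_iff.mp (hd1.trans_ne one_ne_zero)
  calc _ = ‖(d : ℂ_[p])⁻¹ * (charEval p (omegaPow p u) d *
          (anglePow p d k - anglePow p d s))‖ := by
        rw [mul_sub, charEval_mul_anglePow_natCast hk hd, mul_sub, ← pow_sub_one_mul hk0,
          mul_comm (_ ^ _), inv_mul_cancel_left₀ hd0]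
    _ ≤ ‖anglePow p d k - anglePow p d s‖ := by
        rw [norm_mul, norm_inv, hd1, inv_one, one_mul, norm_mul]
        exact mul_le_of_le_one_left (norm_nonneg _) (norm_charEval_le_one _ _)
    _ ≤ ‖(k : ℂ_[p]) - s‖ :=
        norm_anglePow_sub_le hp hunit hs (IsUltrametricDist.norm_natCast_le_one _ k)

theorem norm_natCast_le_inv_p {d : ℕ} (hd : ¬p.Coprime d) : ‖(d : ℂ_[p])‖ ≤ (p : ℝ)⁻¹ := by
  rw [norm_natCast, norm_le_inv_p_iff_dvd]
  exact not_not.mp (mt isUnit_iff_not_dvd.mpr (mt isUnit_natCast_iff.mp hd))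

theorem norm_sigma_sub_familyCoeff_le (hp : p ≠ 2) (hs : ‖s‖ ≤ 1) (hk0 : k ≠ 0)
    (hk : (k : ZMod (p - 1)) = u) {n : ℕ} (hn : n ≠ 0) :
    ‖(ArithmeticFunction.sigma (k - 1) n : ℂ_[p]) - familyCoeff p s (omegaPow p u) 0 n‖ ≤
      max ((p : ℝ)⁻¹ ^ (k - 1)) ‖(k : ℂ_[p]) - s‖ := by
  simp only [familyCoeff_of_ne_zero _ _ _ hn, zero_add]
  rw [Finset.sum_filter, ArithmeticFunction.sigma_apply, Nat.cast_sum, ← Finset.sum_sub_distrib]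
  refine IsUltrametricDist.norm_sum_le_of_forall_le_of_nonneg (le_max_of_le_right (norm_nonneg _))
    fun d _ => ?_
  rw [Nat.cast_pow]
  split_ifs with hd
  · exact le_max_of_le_right (norm_pow_sub_charEval_mul_anglePow_le hp hs hk0 hk hd)
  · rw [sub_zero, norm_pow]
    exact le_max_of_le_left (pow_le_pow_left₀ (norm_nonneg _) (norm_natCast_le_inv_p hd) _)

end HigherCoefficients

section Weights

variable {s : ℤ_[p]} {u : ZMod (p - 1)}

theorem even_of_natCast_eq (hp : p ≠ 2) (hu : Even u) {k : ℕ} (hk : (k : ZMod (p - 1)) = u) :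
    Even k := by
  have hdvd : 2 ∣ p - 1 := ((Fact.out : p.Prime).even_sub_one hp).two_dvd
  have hmap := (hk ▸ hu).map (ZMod.castHom hdvd (ZMod 2))
  rw [map_natCast] at hmap
  obtain ⟨r, hr⟩ := hmap
  rwa [CharTwo.add_self_eq_zero, ZMod.natCast_eq_zero_iff_even] at hr

variable (s u) in
theorem exists_natCast_near (i : ℕ) :
    ∃ k : ℕ, i + 4 ≤ k ∧ (p : ℤ_[p]) ^ i ∣ (k : ℤ_[p]) - s ∧ (k : ZMod (p - 1)) = u := by
  have hp : p.Prime := Fact.out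
  have := neZero_p_sub_one (p := p)
  have hcop : (p ^ i).Coprime (p - 1) :=
    ((Nat.coprime_self_sub_right hp.one_le).mpr (Nat.coprime_one_right p)).pow_left i
  obtain ⟨c, hcs, hcu⟩ := Nat.chineseRemainder hcop (s.appr i) u.val
  have hperiod : 0 < p ^ i * (p - 1) := mul_pos (pow_pos hp.pos i) (Nat.sub_pos_of_lt hp.one_lt)
  refine ⟨c + p ^ i * (p - 1) * (i + 4), ?_, ?_, ?_⟩
  · exact (Nat.le_mul_of_pos_left _ hperiod).trans (Nat.le_add_left _ _)
  · have happr : (p : ℤ_[p]) ^ i ∣ s - s.appr i :=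
      Ideal.mem_span_singleton.mp (PadicInt.appr_spec i s)
    obtain ⟨m, hm⟩ := hcs.symm.dvd
    have hc : (c : ℤ_[p]) - s.appr i = p ^ i * m := by
      exact_mod_cast congrArg (Int.cast : ℤ → ℤ_[p]) hm
    have hdvd : (p : ℤ_[p]) ^ i ∣
        (c - s.appr i) - (s - s.appr i) + p ^ i * ((p - 1) * (i + 4) : ℕ) :=
      dvd_add (dvd_sub ⟨m, hc⟩ happr) (dvd_mul_right _ _)
    convert hdvd using 1
    rw [mul_assoc, Nat.cast_add, Nat.cast_mul (p ^ i), Nat.cast_pow]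
    ring
  · rw [Nat.cast_add, Nat.cast_mul, Nat.cast_mul, ZMod.natCast_self, mul_zero, zero_mul, add_zero,
      (ZMod.natCast_eq_natCast_iff _ _ _).mpr hcu, ZMod.natCast_zmod_val]

theorem exists_isWeightSeq (hp : p ≠ 2) (s : ℤ_[p]) (hu : Even u) : ∃ k, IsWeightSeq s u k := by
  choose k hge hdvd hmod using exists_natCast_near s u
  refine ⟨k, fun i => le_of_add_le_right (hge i), fun i => even_of_natCast_eq hp hu (hmod i),
    tendsto_atTop_mono (fun i => le_of_add_le_left (hge i)) tendsto_id, ?_⟩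
  rw [nhds_prod_eq]
  refine Tendsto.prodMk ?_ (by simpa only [hmod] using tendsto_const_nhds)
  rw [tendsto_iff_norm_sub_tendsto_zero]
  exact squeeze_zero (fun _ => norm_nonneg _) (fun i => norm_le_inv_p_pow_iff_dvd.mpr (hdvd i))
    (tendsto_pow_atTop_nhds_zero_of_lt_one (by positivity) inv_p_lt_one)

namespace IsWeightSeq

variable {k : ℕ → ℕ}

theorem tendsto_natCast (hk : IsWeightSeq s u k) :
    Tendsto (fun i => (k i : ℂ_[p])) atTop (𝓝 (toCp p s)) := by
  simpa [Function.comp_def] using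
    (isometry_toCp.continuous.tendsto s).comp ((continuous_fst.tendsto _).comp hk.weight)

theorem eventually_natCast_eq (hk : IsWeightSeq s u k) :
    ∀ᶠ i in atTop, (k i : ZMod (p - 1)) = u := by
  simpa [nhds_discrete, tendsto_pure] using (continuous_snd.tendsto _).comp hk.weight

theorem tendsto_sub_one (hk : IsWeightSeq s u k) : Tendsto (fun i => k i - 1) atTop atTop :=
  (tendsto_sub_atTop_nat 1).comp hk.tendsto_atTop

end IsWeightSeq

end Weights

section Convergence

variable {s : ℤ_[p]} {u : ZMod (p - 1)}

theorem coeff_zero_classicalEisenstein {k : ℕ} (hk2 : 2 ≤ k) (hk : (k : ZMod (p - 1)) = u) :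
    ((PowerSeries.coeff 0 (classicalEisenstein k) : ℚ) : ℂ_[p]) =
      (1 - (p : ℂ_[p]) ^ (k - 1))⁻¹ * familyCoeff p k (omegaPow p u) 0 0 := by
  have hk0 : k ≠ 0 := by omega
  have hkp : (k : ℂ_[p]) ≠ 0 := Nat.cast_ne_zero.mpr hk0
  have heuler : 1 - (p : ℂ_[p]) ^ (k - 1) ≠ 0 := by
    intro h
    have hnorm := congrArg norm (sub_eq_zero.mp h)
    rw [norm_one, norm_pow, norm_p] at hnorm
    exact (pow_lt_one₀ (by positivity) (inv_p_lt_one (p := p)) (by omega)).ne' hnorm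
  rw [familyCoeff, if_pos rfl, hurwitzZeta_one_sub_natCast hk0 hk, classicalEisenstein,
    PowerSeries.coeff_mk, if_pos rfl]
  push_cast
  field_simp

theorem coeff_classicalEisenstein_of_ne_zero (k : ℕ) {n : ℕ} (hn : n ≠ 0) :
    PowerSeries.coeff n (classicalEisenstein k) = ArithmeticFunction.sigma (k - 1) n := by
  rw [classicalEisenstein, PowerSeries.coeff_mk, if_neg hn]

namespace IsWeightSeq

variable {k : ℕ → ℕ}

theorem tendsto_coeff_zero (hp : p ≠ 2) (hk : IsWeightSeq s u k) (hsu : (s, u) ≠ (0, 0)) :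
    Tendsto (fun i => ((PowerSeries.coeff 0 (classicalEisenstein (k i)) : ℚ) : ℂ_[p])) atTop
      (𝓝 (familyCoeff p (toCp p s) (omegaPow p u) 0 0)) := by
  have hregular : toCp p s ≠ 0 ∨ omegaPow p u ≠ 1 := by
    refine or_iff_not_imp_left.mpr fun hs => omegaPow_ne_one fun hu => hsu ?_
    rw [toCp_eq_zero_iff.mp (not_not.mp hs), hu]
  have hzeta : ContinuousAt (fun t => familyCoeff p t (omegaPow p u) 0 0) (toCp p s) :=
    (continuousAt_hurwitzZeta_one_sub hp one_ne_zero
      ((norm_toCp_le_one s).trans_lt (one_lt_weightRadius hp)) hregular).const_mul (1 / 2)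
  have heuler : Tendsto (fun i => (1 - (p : ℂ_[p]) ^ (k i - 1))⁻¹) atTop (𝓝 1) := by
    simpa using ((tendsto_p_pow.comp hk.tendsto_sub_one).const_sub 1).inv₀ (by simp)
  have hprod := heuler.mul (hzeta.tendsto.comp hk.tendsto_natCast)
  rw [one_mul] at hprod
  refine hprod.congr' ?_
  filter_upwards [hk.eventually_natCast_eq] with i hi
  exact (coeff_zero_classicalEisenstein (le_of_add_le_right (hk.four_le i)) hi).symm

theorem tendstoUniformly_coeff (hp : p ≠ 2) (hk : IsWeightSeq s u k) (hsu : (s, u) ≠ (0, 0)) :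
    TendstoUniformly
      (fun i n => ((PowerSeries.coeff n (classicalEisenstein (k i)) : ℚ) : ℂ_[p]))
      (fun n => PowerSeries.coeff n (family p (toCp p s) (omegaPow p u) 0)) atTop := by
  rw [Metric.tendstoUniformly_iff]
  intro ε hε
  have hpow := (tendsto_pow_atTop_nhds_zero_of_lt_one (by positivity)
    (inv_p_lt_one (p := p))).comp hk.tendsto_sub_one
  filter_upwards [hk.eventually_natCast_eq, hpow.eventually_lt_const hε,
    Metric.tendsto_nhds.mp hk.tendsto_natCast ε hε,
    Metric.tendsto_nhds.mp (hk.tendsto_coeff_zero hp hsu) ε hε] with i hi hpi hsi hzero n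
  rw [dist_comm, family, PowerSeries.coeff_mk]
  by_cases hn : n = 0
  · rw [hn]
    exact hzero
  · rw [dist_eq_norm] at hsi ⊢
    have hk0 : k i ≠ 0 := (Nat.zero_lt_of_lt (hk.four_le i)).ne'
    rw [coeff_classicalEisenstein_of_ne_zero _ hn, Rat.cast_natCast]
    exact (norm_sigma_sub_familyCoeff_le hp (norm_toCp_le_one s) hk0 hi hn).trans_lt
      (max_lt hpi hsi)

end IsWeightSeq

theorem isSerreEisenstein_family (hp : p ≠ 2) (hu : Even u) (hsu : (s, u) ≠ (0, 0)) :
    IsSerreEisenstein s u (family p (toCp p s) (omegaPow p u) 0) :=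
  ⟨exists_isWeightSeq hp s hu, fun _ hk => hk.tendstoUniformly_coeff hp hsu⟩

end Convergence

end PadicEisenstein

theorem proposition3p5 (p : ℕ) [Fact p.Prime] (hp : p ≠ 2)
    (s : ℤ_[p]) (u : ZMod (p - 1)) (hu : Even u) (hsu : (s, u) ≠ (0, 0)) :
    PadicEisenstein.IsSerreEisenstein s u (PadicEisenstein.serreEisenstein p s u) ∧
      PadicEisenstein.family p (PadicEisenstein.toCp p s) (PadicEisenstein.omegaPow p u) 0 =
        PadicEisenstein.serreEisenstein p s u := by
  have h := PadicEisenstein.isSerreEisenstein_family hp hu hsu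
  have h' : PadicEisenstein.IsSerreEisenstein s u (PadicEisenstein.serreEisenstein p s u) :=
    Classical.epsilon_spec ⟨_, h⟩
  exact ⟨h', h.unique h'⟩
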